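/- Let $c$ denote Euler's constant and, for a positive real number $q$, put $$L(q)=\lim_{\tau\to\infty}\frac1\tau\int_0^{q\,\frac{\tau}{\ln(2\pi)-2c}}\left\{\ln t-\left|\zeta\left(\tfrac12+it\right)\right|^2\right\}dt .$$ A Fermat rational is a number of the form $\frac{x^n+y^n}{z^n}$ with positive integers $x,y,z,n$ and $n\ge 3$. Then for every fixed $\varepsilon>0$ (in particular every small one) the limit $L(q)$ exists for every Fermat rational $q\in(1-\varepsilon,1+\varepsilon)$, and the condition $$L\left(\frac{x^n+y^n}{z^n}\right)\ne 1\quad\text{for all Fermat rationals } \frac{x^n+y^n}{z^n}\in(1-\varepsilon,1+\varepsilon)$$ is equivalent to the Fermat–Wiles theorem, that is, to the assertion that $x^n+y^n=z^n$ has no solution in positive integers $x,y,z,n$ with $n\ge3$. -/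

import Mathlib

open Filter Topology

/-- The integrand `ln t - |ζ(1/2 + i t)|²`. -/
noncomputable def logZetaIntegrand (t : ℝ) : ℝ :=
  Real.log t - ‖riemannZeta (1 / 2 + (t : ℂ) * Complex.I)‖ ^ 2

/-- The logarithmic modification of the Hardy-Littlewood integral,
`J₁(T) = ∫₀ᵀ (ln t - |ζ(1/2 + i t)|²) dt`. -/
noncomputable def logHardyLittlewood (T : ℝ) : ℝ :=
  ∫ t in (0 : ℝ)..T, logZetaIntegrand t

/-- `(1/τ) J₁(q τ / (ln (2π) - 2c))`, where `c` is Euler's constant. -/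
noncomputable def logZetaMean (q τ : ℝ) : ℝ :=
  1 / τ * logHardyLittlewood
    (q * (τ / (Real.log (2 * Real.pi) - 2 * Real.eulerMascheroniConstant)))

/-- `L(q) = lim_{τ → ∞} (1/τ) J₁(q τ / (ln (2π) - 2c))`. -/
noncomputable def logZetaLimit (q : ℝ) : ℝ :=
  limUnder atTop (logZetaMean q)

/-- Fermat's rationals: the numbers `(xⁿ + yⁿ) / zⁿ` with positive integers `x, y, z` and
`n ≥ 3`. -/
def IsFermatRational (q : ℝ) : Prop :=
  ∃ x y z n : ℕ, 0 < x ∧ 0 < y ∧ 0 < z ∧ 3 ≤ n ∧ q = ((x : ℝ) ^ n + (y : ℝ) ^ n) / (z : ℝ) ^ n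

namespace ZetaMeanSquare
open Complex MeasureTheory Set
open scoped Real

/-! The point is that L(q) = q for every q > 0. This is the Hardy–Littlewood mean value in the form
∫₀ᵀ (|ζ(1/2+it)|² − ln t) dt = (2c − ln 2π) T + o(T): after division by τ the factor ln 2π − 2c
cancels. A Fermat rational with L(q) = 1 is then a Fermat rational equal to 1, i.e. a counterexample
to Fermat, and 1 lies in every interval (1−ε, 1+ε). No part of Fermat–Wiles is proved or used.

The mean value is obtained by Titchmarsh's method. The Lambert series ∑ d(n) exp(−nz) has Mellin
transform Γ(s)ζ(s)². Removing its singular part (γ − log z)/z makes the transform valid in 0 < re s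
< 1 (`hasMellin_lambertReg`), and on the critical line the functional equation turns it into (2π)^s
|ζ|²/(2 cos(πs/2)) (`Gamma_mul_zeta_sq`). Mellin inversion and analytic continuation give an
integral formula at 2π exp y for |im y| < π/2 (`lambertStrip_eq_integral`). At y = i(π/2 − w) the
exponential cancels the decay of the kernel, and the integral becomes the Laplace transform of |ζ|²
at w up to a bounded factor. There 2π exp y is close to 2πi, and 2πi-periodicity moves it to a point
close to 2πw, where the series is again governed by its singular part. Hence the Laplace transform
is (γ − log 2πw)/w with an error uniform in the half plane strip 0 < re w ≤ 1
(`exists_norm_zetaLaplace_sub_le`).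

That main term is exactly the Laplace transform of ln t + 2γ − ln 2π. Perron's formula with the
absolutely convergent kernel w⁻² bounds the Riesz mean of the difference by Y^(3/2), and since |ζ|²
≥ 0 a one-sided Tauberian argument recovers the plain integral with error Y^(7/8)
(`exists_abs_integral_zetaDev_le`). -/

/-! ### Linear growth of ζ on the critical line. -/

/-- The fractional part of `1 / y`, cut off at `y = 1`. -/
noncomputable def fractInv (y : ℝ) : ℂ := (Ioc (0 : ℝ) 1).indicator (fun y ↦ ((Int.fract y⁻¹ : ℝ) : ℂ)) y

lemma norm_fractInv_le (y : ℝ) : ‖fractInv y‖ ≤ 1 := by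
  unfold fractInv
  by_cases h : y ∈ Ioc (0 : ℝ) 1
  · rw [indicator_of_mem h, norm_real, Real.norm_of_nonneg (Int.fract_nonneg _)]
    exact (Int.fract_lt_one _).le
  · simp [indicator_of_notMem h]

lemma measurable_fractInv : Measurable fractInv := by
  unfold fractInv
  exact Measurable.indicator (by fun_prop) measurableSet_Ioc

lemma differentiableAt_mellin_fractInv {s : ℂ} (hs : 0 < s.re) :
    DifferentiableAt ℂ (mellin fractInv) s := by
  refine mellin_differentiableAt_of_isBigO_rpow (a := s.re + 1) (b := 0) ?_ ?_ (by linarith) ?_ hs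
  · refine LocallyIntegrable.locallyIntegrableOn ?_ _
    refine (locallyIntegrable_const (1 : ℝ)).mono measurable_fractInv.aestronglyMeasurable ?_
    exact .of_forall fun y ↦ by simpa using norm_fractInv_le y
  · refine Asymptotics.IsBigO.of_bound 1 ?_
    filter_upwards [eventually_gt_atTop 1] with y hy
    rw [fractInv, indicator_of_notMem (by simp [hy])]
    simp only [norm_zero]; positivity
  · refine Asymptotics.IsBigO.of_bound 1 ?_
    exact .of_forall fun y ↦ by simpa using norm_fractInv_le y

lemma mellin_fractInv (s : ℂ) :
    mellin fractInv s = ∫ t in Ioi (1 : ℝ), ((Int.fract t : ℝ) : ℂ) * (t : ℂ) ^ (-(s + 1)) := by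
  have h1 : mellin fractInv s = mellin (fun t ↦ fractInv t⁻¹) (-s) := by
    rw [mellin_comp_inv, neg_neg]
  -- The cut-off keeps y = 1, so inversion produces the half line closed at 1; the extra point is
  -- null.
  rw [h1, mellin, ← integral_indicator measurableSet_Ioi, ← integral_Ici_eq_integral_Ioi,
    ← integral_indicator measurableSet_Ici]
  congr 1
  ext t
  simp only [indicator, fractInv, mem_Ioi, mem_Ioc, mem_Ici, smul_eq_mul]
  by_cases h0 : 0 < t
  · by_cases h1 : 1 ≤ t
    · have : t⁻¹ ≤ 1 := inv_le_one_of_one_le₀ h1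
      simp [h0, h1, this]
      ring_nf
    · have : ¬ t⁻¹ ≤ 1 := by
        rw [inv_le_one₀ h0]; exact h1
      simp [h0, h1, this]
  · have : ¬ 1 ≤ t := by linarith
    simp [h0, this]

lemma norm_mellin_fractInv_le (t : ℝ) : ‖mellin fractInv (1 / 2 + t * I)‖ ≤ 2 := by
  have h2 : ∫ x in Ioc (0:ℝ) 1, x ^ (-(1 / 2) : ℝ) = 2 := by
    rw [← intervalIntegral.integral_of_le zero_le_one, integral_rpow (by left; norm_num)]
    norm_num
  have hi : IntegrableOn (fun x : ℝ ↦ x ^ (-(1 / 2) : ℝ)) (Ioc 0 1) :=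
    (intervalIntegrable_iff_integrableOn_Ioc_of_le zero_le_one).1
      (intervalIntegral.intervalIntegrable_rpow' (by norm_num))
  rw [mellin, ← h2, ← integral_indicator measurableSet_Ioi, ← integral_indicator measurableSet_Ioc]
  refine norm_integral_le_of_norm_le ((integrable_indicator_iff measurableSet_Ioc).2 hi) ?_
  refine .of_forall fun x ↦ ?_
  simp only [indicator, mem_Ioi, mem_Ioc]
  by_cases h0 : 0 < x
  · by_cases h1 : x ≤ 1
    · simp only [h0, h1, if_true, and_self, norm_smul, norm_cpow_eq_rpow_re_of_pos h0]
      have : (1 / 2 + (t : ℂ) * I - 1).re = -(1 / 2) := by simp; norm_num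
      rw [this]
      exact mul_le_of_le_one_right (by positivity) (norm_fractInv_le x)
    · simp [h0, h1, fractInv]
  · simp [h0]

/-- Abel summation: the partial sums of the coefficients 1 are ⌊t⌋ = t − {t}; the term t integrates
to 1/(s − 1) and the term {t} to the Mellin transform. -/
lemma riemannZeta_eq_mellin_fractInv_of_one_lt {s : ℂ} (hs : 1 < s.re) :
    riemannZeta s = s / (s - 1) - s * mellin fractInv s := by
  have h1 : LSeries (fun _ ↦ 1) s = s * ∫ t in Ioi (1 : ℝ),
      (∑ k ∈ Finset.Icc 1 ⌊t⌋₊, (fun _ ↦ (1 : ℂ)) k) * (t : ℂ) ^ (-(s + 1)) := by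
    refine LSeries_eq_mul_integral _ zero_le_one hs ?_ ?_
    · exact (LSeriesSummable_one_iff (s := s)).2 hs
    · refine Asymptotics.IsBigO.of_bound 1 (.of_forall fun n ↦ ?_)
      simp
  have hs1 : s - 1 ≠ 0 := by
    intro h; rw [sub_eq_zero] at h; simp [h] at hs
  have h2 : ∫ t in Ioi (1 : ℝ), (t : ℂ) ^ (-s) = 1 / (s - 1) := by
    rw [integral_Ioi_cpow_of_lt (by simpa using hs) one_pos]
    simp only [ofReal_one, one_cpow]
    rw [show -s + 1 = -(s - 1) by ring, neg_div_neg_eq]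
  have e1 : IntegrableOn (fun t : ℝ ↦ (t : ℂ) ^ (-s)) (Ioi 1) :=
    integrableOn_Ioi_cpow_of_lt (by simpa using hs) one_pos
  have e2 : IntegrableOn (fun t : ℝ ↦ ((Int.fract t : ℝ) : ℂ) * (t : ℂ) ^ (-(s + 1))) (Ioi 1) := by
    have e0 : IntegrableOn (fun t : ℝ ↦ (t : ℂ) ^ (-(s + 1))) (Ioi 1) :=
      integrableOn_Ioi_cpow_of_lt (by simp; linarith) one_pos
    refine Integrable.bdd_mul (c := 1) e0 (Measurable.aestronglyMeasurable (by fun_prop)) ?_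
    refine .of_forall fun t ↦ ?_
    rw [norm_real, Real.norm_of_nonneg (Int.fract_nonneg _)]
    exact (Int.fract_lt_one _).le
  rw [← LSeries_one_eq_riemannZeta hs]
  change LSeries (fun _ ↦ 1) s = _
  rw [h1, mellin_fractInv, div_eq_mul_one_div, ← h2, ← mul_sub, ← integral_sub e1 e2]
  congr 1
  refine setIntegral_congr_fun measurableSet_Ioi fun t (ht : 1 < t) ↦ ?_
  have ht0 : (t : ℂ) ≠ 0 := by exact_mod_cast (by linarith : t ≠ 0)
  have : (t : ℂ) ^ (-s) = t * (t : ℂ) ^ (-(s + 1)) := by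
    rw [show -s = 1 + -(s + 1) by ring, cpow_add _ _ ht0, cpow_one]
  simp only [this, Finset.sum_const, Nat.card_Icc, add_tsub_cancel_right, nsmul_eq_mul, mul_one]
  rw [← sub_mul]
  congr 1
  have := Int.self_sub_fract t
  rw [← ofReal_sub, this, ← natCast_floor_eq_intCast_floor (by linarith)]
  simp

/-- Uniqueness of analytic continuation from `re s > 1` to `re s > 0`. -/
lemma eq_of_eqOn_one_lt_re {f g : ℂ → ℂ} (hf : ∀ s : ℂ, 0 < s.re → DifferentiableAt ℂ f s)
    (hg : ∀ s : ℂ, 0 < s.re → DifferentiableAt ℂ g s) (h : ∀ s : ℂ, 1 < s.re → f s = g s)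
    {s : ℂ} (hs : 0 < s.re) : f s = g s := by
  have hU : IsOpen {s : ℂ | 0 < s.re} := isOpen_lt continuous_const continuous_re
  have hfU : AnalyticOnNhd ℂ f {s : ℂ | 0 < s.re} :=
    DifferentiableOn.analyticOnNhd (fun s hs ↦ (hf s hs).differentiableWithinAt) hU
  have hgU : AnalyticOnNhd ℂ g {s : ℂ | 0 < s.re} :=
    DifferentiableOn.analyticOnNhd (fun s hs ↦ (hg s hs).differentiableWithinAt) hU
  refine hfU.eqOn_of_preconnected_of_eventuallyEq hgU
    (convex_halfSpace_re_gt 0).isPreconnected (z₀ := 2) (by simp) ?_ hs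
  filter_upwards [(isOpen_lt continuous_const continuous_re).mem_nhds
    (show (2 : ℂ) ∈ {s : ℂ | 1 < s.re} by simp)] with z hz using h z hz

/-- Multiplying by s − 1 removes the pole at 1, so both sides are holomorphic in the whole half
plane re s > 0 and the identity theorem applies. -/
lemma riemannZeta_eq_mellin_fractInv {s : ℂ} (hs : 0 < s.re) (hs1 : s ≠ 1) :
    riemannZeta s = s / (s - 1) - s * mellin fractInv s := by
  have hs1' : s - 1 ≠ 0 := sub_ne_zero.2 hs1
  have key : riemannZeta₁ s = s - (s - 1) * (s * mellin fractInv s) := by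
    refine eq_of_eqOn_one_lt_re (f := riemannZeta₁)
      (g := fun s ↦ s - (s - 1) * (s * mellin fractInv s))
      (fun s _ ↦ differentiable_riemannZeta₁ s) (fun s hs ↦ ?_) (fun s hs ↦ ?_) hs
    · have := differentiableAt_mellin_fractInv hs
      fun_prop
    · have hne : s ≠ 1 := by rintro rfl; simp at hs
      have h := riemannZeta_eq_inv_sub_mul hne
      rw [riemannZeta_eq_mellin_fractInv_of_one_lt hs] at h
      have : s - 1 ≠ 0 := sub_ne_zero.2 hne
      field_simp at h
      linear_combination -h
  rw [riemannZeta_eq_inv_sub_mul hs1, key]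
  field_simp

/-- On the line re s = 1/2 one has |s| = |s − 1|, so the polar term has modulus 1. Polynomial growth
is all that is needed, to integrate |ζ|² against exponentials. -/
lemma norm_riemannZeta_half_le (t : ℝ) : ‖riemannZeta (1 / 2 + t * I)‖ ≤ 2 + 2 * |t| := by
  have hs : (1 / 2 + (t : ℂ) * I) ≠ 1 := by
    intro h
    have := congrArg re h
    simp at this
  rw [riemannZeta_eq_mellin_fractInv (by simp) hs]
  have h1 : ‖(1 / 2 + (t : ℂ) * I)‖ = ‖(1 / 2 + (t : ℂ) * I) - 1‖ := by
    rw [norm_def, norm_def]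
    congr 1
    simp [normSq_apply]; norm_num
  have h2 : ‖(1 / 2 + (t : ℂ) * I)‖ ≤ 1 / 2 + |t| := by
    refine (norm_add_le _ _).trans ?_
    simp
  have h3 : ‖(1 / 2 + (t : ℂ) * I) - 1‖ ≠ 0 := by
    rw [norm_ne_zero_iff, sub_ne_zero]; exact hs
  refine (norm_sub_le _ _).trans ?_
  rw [norm_div, norm_mul, h1, div_self h3, ← h1]
  have := norm_mellin_fractInv_le t
  nlinarith [norm_nonneg (1 / 2 + (t : ℂ) * I), norm_nonneg (mellin fractInv (1 / 2 + t * I))]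

/-! ### The Lambert series and its Mellin transform. -/

/-- The product `(m + 1) (k + 1)` indexing the terms of the Lambert series. -/
def prodIndex (p : ℕ × ℕ) : ℕ := (p.1 + 1) * (p.2 + 1)

/-- The Lambert series `∑ d(n) exp (-n z)`, as a double sum. -/
noncomputable def lambert (z : ℂ) : ℂ := ∑' p : ℕ × ℕ, cexp (-(prodIndex p : ℂ) * z)

lemma prodIndex_pos (p : ℕ × ℕ) : (0 : ℝ) < prodIndex p := by
  unfold prodIndex; positivity

/-- Raise y/a ≤ exp(y/a) to the power a. This majorises the Lambert terms by a double series that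
converges for any a > 1. -/
lemma exp_neg_le_rpow {a y : ℝ} (ha : 0 < a) (hy : 0 < y) :
    Real.exp (-y) ≤ a ^ a * y ^ (-a) := by
  have h1 : y / a ≤ Real.exp (y / a) := by linarith [Real.add_one_le_exp (y / a)]
  have h2 : (y / a) ^ a ≤ Real.exp y := by
    calc (y / a) ^ a ≤ (Real.exp (y / a)) ^ a :=
          Real.rpow_le_rpow (by positivity) h1 ha.le
      _ = Real.exp y := by rw [← Real.exp_mul]; congr 1; field_simp
  rw [Real.div_rpow hy.le ha.le, div_le_iff₀ (by positivity)] at h2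
  rw [Real.exp_neg, Real.rpow_neg hy.le, ← div_eq_mul_inv, inv_eq_one_div,
    div_le_div_iff₀ (Real.exp_pos _) (by positivity)]
  linarith

lemma summable_nat_succ_rpow {a : ℝ} (ha : 1 < a) : Summable fun n : ℕ ↦ ((n : ℝ) + 1) ^ (-a) := by
  have := (summable_nat_add_iff 1).2 (Real.summable_nat_rpow.2 (show -a < -1 by linarith))
  simpa using this

lemma summable_prodIndex_rpow {a : ℝ} (ha : 1 < a) :
    Summable fun p : ℕ × ℕ ↦ (prodIndex p : ℝ) ^ (-a) := by
  have h := (summable_nat_succ_rpow ha).mul_of_nonneg (summable_nat_succ_rpow ha)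
    (fun n ↦ by positivity) (fun n ↦ by positivity)
  refine h.congr fun p ↦ ?_
  rw [prodIndex, ← Real.mul_rpow (by positivity) (by positivity)]
  push_cast; rfl

lemma norm_lambert_term (p : ℕ × ℕ) (z : ℂ) :
    ‖cexp (-(prodIndex p : ℂ) * z)‖ = Real.exp (-(prodIndex p * z.re)) := by
  rw [norm_exp]; simp

lemma norm_lambert_term_le {a x : ℝ} (ha : 0 < a) (hx : 0 < x) (p : ℕ × ℕ) {z : ℂ}
    (hz : x ≤ z.re) :
    ‖cexp (-(prodIndex p : ℂ) * z)‖ ≤ a ^ a * x ^ (-a) * (prodIndex p : ℝ) ^ (-a) := by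
  have hp := prodIndex_pos p
  rw [norm_lambert_term]
  calc Real.exp (-(prodIndex p * z.re)) ≤ Real.exp (-(prodIndex p * x)) := by gcongr
    _ ≤ a ^ a * (prodIndex p * x) ^ (-a) := exp_neg_le_rpow ha (by positivity)
    _ = _ := by rw [Real.mul_rpow hp.le hx.le]; ring

lemma summable_lambert_term {z : ℂ} (hz : 0 < z.re) :
    Summable fun p : ℕ × ℕ ↦ cexp (-(prodIndex p : ℂ) * z) :=
  Summable.of_norm_bounded ((summable_prodIndex_rpow one_lt_two).mul_left _)
    fun p ↦ norm_lambert_term_le two_pos hz p le_rfl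

lemma exists_norm_lambert_le {a : ℝ} (ha : 1 < a) :
    ∃ C, ∀ z : ℂ, 0 < z.re → ‖lambert z‖ ≤ C * z.re ^ (-a) := by
  refine ⟨a ^ a * ∑' p : ℕ × ℕ, (prodIndex p : ℝ) ^ (-a), fun z hz ↦ ?_⟩
  refine tsum_of_norm_bounded (((summable_prodIndex_rpow ha).hasSum.mul_left
    (a ^ a * z.re ^ (-a)))) (fun p ↦ norm_lambert_term_le (by linarith) hz p le_rfl) |>.trans_eq ?_
  ring

lemma differentiableAt_lambert {z : ℂ} (hz : 0 < z.re) : DifferentiableAt ℂ lambert z := by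
  have hU : IsOpen {w : ℂ | z.re / 2 < w.re} := isOpen_lt continuous_const continuous_re
  refine (differentiableOn_tsum_of_summable_norm
    ((summable_prodIndex_rpow one_lt_two).mul_left _)
    (fun p ↦ ?_) hU fun p w hw ↦
    norm_lambert_term_le two_pos (half_pos hz) p (le_of_lt hw)).differentiableAt
    (hU.mem_nhds (by simp; linarith))
  fun_prop

/-- All frequencies are integers. This periodicity later transports the expansion at the origin to
the point 2πi. -/
lemma lambert_add_two_pi_I (z : ℂ) : lambert (z + 2 * π * I) = lambert z := by
  unfold lambert
  congr 1
  ext p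
  rw [mul_add, exp_add]
  have : cexp (-(prodIndex p : ℂ) * (2 * π * I)) = 1 :=
    exp_eq_one_iff.2 ⟨-(prodIndex p : ℤ), by push_cast; rfl⟩
  rw [this, mul_one]

/-- Each term exp(−nx) contributes Γ(s) n^(−s), and with n = (m+1)(k+1) the double sum factors as
ζ(s)². -/
lemma mellin_lambert {s : ℂ} (hs : 1 < s.re) :
    mellin (fun x : ℝ ↦ lambert x) s = Gamma s * riemannZeta s ^ 2 := by
  have h := hasSum_mellin (a := fun _ : ℕ × ℕ ↦ (1 : ℂ)) (p := fun p ↦ (prodIndex p : ℝ))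
    (F := fun x : ℝ ↦ lambert x) (s := s) (fun p ↦ Or.inr (prodIndex_pos p)) (by linarith)
    (fun t ht ↦ ?_) ?_
  · rw [← h.tsum_eq, sq, zeta_eq_tsum_one_div_nat_add_one_cpow hs]
    have hsum : Summable fun n : ℕ ↦ ‖1 / ((n : ℂ) + 1) ^ s‖ := by
      refine (summable_nat_succ_rpow hs).congr fun n ↦ ?_
      have := norm_cpow_eq_rpow_re_of_pos (show (0 : ℝ) < (n : ℝ) + 1 by positivity) s
      push_cast at this
      rw [norm_div, norm_one, this, Real.rpow_neg (by positivity), one_div]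
    rw [tsum_mul_tsum_of_summable_norm hsum hsum, ← tsum_mul_left]
    congr 1
    ext p
    have : ((prodIndex p : ℝ) : ℂ) ^ s = ((p.1 : ℂ) + 1) ^ s * ((p.2 : ℂ) + 1) ^ s := by
      have := mul_cpow_ofReal_nonneg (show (0 : ℝ) ≤ (p.1 : ℝ) + 1 by positivity)
        (show (0 : ℝ) ≤ (p.2 : ℝ) + 1 by positivity) s
      rw [prodIndex]
      push_cast at this ⊢
      exact this
    rw [this]
    ring
  · have := (summable_lambert_term (z := (t : ℂ)) (by simpa using ht)).hasSum
    refine this.congr_fun fun p ↦ ?_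
    push_cast
    simp
  · refine (summable_prodIndex_rpow hs).congr fun p ↦ ?_
    rw [Real.rpow_neg (prodIndex_pos p).le, norm_one, one_div]

/-! ### The singular part of the Lambert series at 0, on the real axis. -/

/-- The difference between `1 / y` and `1 / (exp y - 1)`. -/
noncomputable def bosePsi (y : ℝ) : ℝ := 1 / y - 1 / (Real.exp y - 1)

/-- The primitive of `bosePsi` vanishing at `0`. -/
noncomputable def bosePhi (y : ℝ) : ℝ := Real.log y - Real.log (1 - Real.exp (-y))

lemma exp_sub_one_pos {y : ℝ} (hy : 0 < y) : 0 < Real.exp y - 1 := by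
  linarith [Real.add_one_lt_exp hy.ne']

lemma one_sub_exp_neg_pos {y : ℝ} (hy : 0 < y) : 0 < 1 - Real.exp (-y) := by
  have := Real.exp_lt_exp.2 (neg_lt_zero.2 hy)
  rw [Real.exp_zero] at this
  linarith

lemma hasDerivAt_bosePhi {y : ℝ} (hy : 0 < y) : HasDerivAt bosePhi (bosePsi y) y := by
  have h1 := Real.hasDerivAt_log hy.ne'
  have h2 : HasDerivAt (fun y ↦ Real.log (1 - Real.exp (-y))) (Real.exp (-y) / (1 - Real.exp (-y))) y := by
    have h3 : HasDerivAt (fun y ↦ 1 - Real.exp (-y)) (Real.exp (-y)) y := by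
      have := ((hasDerivAt_neg y).exp).const_sub 1
      simpa using this
    exact h3.log (one_sub_exp_neg_pos hy).ne'
  refine (h1.sub h2).congr_deriv (Eq.symm ?_)
  have := exp_sub_one_pos hy
  have := one_sub_exp_neg_pos hy
  rw [bosePsi, one_div, sub_right_inj, div_eq_div_iff (by positivity) (by positivity)]
  have h5 : Real.exp (-y) * Real.exp y = 1 := by rw [← Real.exp_add]; simp
  linear_combination -h5

/-- The sign of the derivative amounts to y² exp y ≤ (exp y − 1)², which is the square of y ≤ 2
sinh(y/2) times exp(y/2). -/
lemma antitoneOn_bosePsi : AntitoneOn bosePsi (Ioi 0) := by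
  have hd : ∀ y : ℝ, 0 < y →
      HasDerivAt bosePsi (-1 / y ^ 2 + Real.exp y / (Real.exp y - 1) ^ 2) y := by
    intro y hy
    have h1 := (hasDerivAt_id y).fun_inv hy.ne'
    have h2 := ((Real.hasDerivAt_exp y).sub_const 1).fun_inv (exp_sub_one_pos hy).ne'
    have := h1.sub h2
    refine (this.congr_of_eventuallyEq (.of_forall fun y ↦ ?_)).congr_deriv ?_
    · simp [bosePsi]
    · simp; ring
  refine antitoneOn_of_deriv_nonpos (convex_Ioi 0)
    (fun y hy ↦ (hd y hy).continuousAt.continuousWithinAt) ?_ ?_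
  · rw [interior_Ioi]
    exact fun y hy ↦ (hd y hy).differentiableAt.differentiableWithinAt
  · rw [interior_Ioi]
    intro y (hy : 0 < y)
    rw [(hd y hy).deriv]
    have h1 := exp_sub_one_pos hy
    have h2 : y ≤ Real.exp (y / 2) - Real.exp (-(y / 2)) := by
      have := Real.self_le_sinh_iff.2 (show 0 ≤ y / 2 by positivity)
      rw [Real.sinh_eq] at this
      linarith
    have h3 : y * Real.exp (y / 2) ≤ Real.exp y - 1 := by
      calc y * Real.exp (y / 2) ≤ (Real.exp (y / 2) - Real.exp (-(y / 2))) * Real.exp (y / 2) := by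
            gcongr
        _ = Real.exp y - 1 := by
            rw [sub_mul, ← Real.exp_add, ← Real.exp_add]; simp
    have h4 : y ^ 2 * Real.exp y ≤ (Real.exp y - 1) ^ 2 := by
      have : y ^ 2 * Real.exp y = (y * Real.exp (y / 2)) ^ 2 := by
        rw [mul_pow, ← Real.exp_nat_mul]; congr 2; push_cast; ring
      rw [this]
      exact pow_le_pow_left₀ (by positivity) h3 2
    have : Real.exp y / (Real.exp y - 1) ^ 2 ≤ 1 / y ^ 2 := by
      rw [div_le_div_iff₀ (by positivity) (by positivity)]; linarith
    rw [neg_div]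
    linarith

lemma bosePhi_sub_mem {a b : ℝ} (ha : 0 < a) (hab : a ≤ b) :
    (b - a) * bosePsi b ≤ bosePhi b - bosePhi a ∧ bosePhi b - bosePhi a ≤ (b - a) * bosePsi a := by
  have hc : ContinuousOn bosePhi (Icc a b) := fun y hy ↦
    (hasDerivAt_bosePhi (ha.trans_le hy.1)).continuousAt.continuousWithinAt
  have hd : DifferentiableOn ℝ bosePhi (interior (Icc a b)) := fun y hy ↦
    (hasDerivAt_bosePhi (ha.trans_le (interior_subset hy).1)).differentiableAt.differentiableWithinAt
  constructor
  · rw [mul_comm]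
    refine (convex_Icc a b).mul_sub_le_image_sub_of_le_deriv hc hd (fun y hy ↦ ?_) a
      (left_mem_Icc.2 hab) b (right_mem_Icc.2 hab) hab
    have hy' := interior_subset hy
    rw [(hasDerivAt_bosePhi (ha.trans_le hy'.1)).deriv]
    exact antitoneOn_bosePsi (ha.trans_le hy'.1) (ha.trans_le hab) hy'.2
  · rw [mul_comm]
    refine (convex_Icc a b).image_sub_le_mul_sub_of_deriv_le hc hd (fun y hy ↦ ?_) a
      (left_mem_Icc.2 hab) b (right_mem_Icc.2 hab) hab
    have hy' := interior_subset hy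
    rw [(hasDerivAt_bosePhi (ha.trans_le hy'.1)).deriv]
    exact antitoneOn_bosePsi ha (ha.trans_le hy'.1) hy'.1

lemma mul_bosePsi_mem {x : ℝ} (hx : 0 < x) : 0 ≤ x * bosePsi x ∧ x * bosePsi x ≤ x := by
  have h := exp_sub_one_pos hx
  have h1 : x * bosePsi x = 1 - x / (Real.exp x - 1) := by
    unfold bosePsi; field_simp
  rw [h1]
  constructor
  · rw [sub_nonneg, div_le_one h]; linarith [Real.add_one_le_exp x]
  · rw [sub_le_comm, le_div_iff₀ h]
    have h2 := Real.add_one_le_exp (-x)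
    have h3 : Real.exp (-x) * Real.exp x = 1 := by rw [← Real.exp_add]; simp
    nlinarith [Real.exp_pos x]

lemma bosePhi_mem {x : ℝ} (hx : 0 < x) : 0 ≤ bosePhi x ∧ bosePhi x ≤ x := by
  have h := one_sub_exp_neg_pos hx
  unfold bosePhi
  constructor
  · rw [sub_nonneg]
    exact Real.log_le_log h (by linarith [Real.add_one_le_exp (-x)])
  · rw [← Real.log_div hx.ne' h.ne', Real.log_le_iff_le_exp (by positivity), div_le_iff₀ h,
      mul_sub, ← Real.exp_add]
    simp
    linarith [Real.add_one_le_exp x]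

/-- The sum is a Riemann sum of mesh x for a decreasing function with primitive `bosePhi`. Lower and
upper sums bracket the integral from x on, and the leftover pieces x·`bosePsi` x and `bosePhi` x
both lie in [0, x]. -/
lemma abs_sum_bosePsi_sub_le {x : ℝ} (hx : 0 < x) (M : ℕ) :
    |∑ m ∈ Finset.range (M + 1), x * bosePsi ((m + 1) * x) - bosePhi ((M + 1) * x)| ≤ x := by
  have key : ∑ m ∈ Finset.range (M + 1), x * bosePsi ((m + 1) * x) - x * bosePsi x
        ≤ bosePhi ((M + 1) * x) - bosePhi x ∧
      bosePhi ((M + 1) * x) - bosePhi x ≤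
        ∑ m ∈ Finset.range (M + 1), x * bosePsi ((m + 1) * x) - x * bosePsi ((M + 1) * x) := by
    induction M with
    | zero => simp
    | succ M ih =>
      have h := bosePhi_sub_mem (a := (M + 1) * x) (b := (M + 1 + 1) * x) (by positivity)
        (by nlinarith)
      rw [show ((M : ℝ) + 1 + 1) * x - (M + 1) * x = x by ring] at h
      rw [Finset.sum_range_succ]
      push_cast
      constructor <;> linarith [h.1, h.2, ih.1, ih.2]
  have h1 := mul_bosePsi_mem hx
  have h2 := bosePhi_mem hx
  have h3 : 0 ≤ x * bosePsi ((M + 1) * x) := by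
    have := (mul_bosePsi_mem (show 0 < ((M : ℝ) + 1) * x by positivity)).1
    have h4 : 0 ≤ bosePsi ((M + 1) * x) := nonneg_of_mul_nonneg_right this (by positivity)
    positivity
  rw [abs_le]
  constructor <;> linarith [key.1, key.2]

lemma hasSum_lambert_ofReal {x : ℝ} (hx : 0 < x) :
    HasSum (fun m : ℕ ↦ ((1 / (Real.exp ((m + 1) * x) - 1) : ℝ) : ℂ)) (lambert x) := by
  refine (summable_lambert_term (z := x) (by simpa)).hasSum.prod_fiberwise fun m ↦ ?_
  have hm : 0 < ((m : ℝ) + 1) * x := by positivity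
  have hq := one_sub_exp_neg_pos hm
  have h := (hasSum_geometric_of_lt_one (Real.exp_pos (-((m + 1) * x))).le
    (by linarith)).mul_left (Real.exp (-((m + 1) * x)))
  have h2 := (hasSum_ofReal (f := fun n : ℕ ↦ _) (x := _)).2 h
  have e1 : Real.exp (-((m + 1) * x)) * (1 - Real.exp (-((m + 1) * x)))⁻¹
      = 1 / (Real.exp ((m + 1) * x) - 1) := by
    have := exp_sub_one_pos hm
    rw [← div_eq_mul_inv, div_eq_div_iff hq.ne' this.ne', mul_sub, ← Real.exp_add]
    simp
  rw [e1] at h2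
  refine h2.congr_fun fun k ↦ ?_
  rw [← Real.exp_nat_mul, ← Real.exp_add, prodIndex]
  push_cast
  congr 1
  ring

/-- Write 1/(exp(mx) − 1) = 1/(mx) − `bosePsi`(mx). The first terms sum to a harmonic number over x,
the second to `bosePhi`((M+1)x)/x with error at most 1; the two logarithms of M + 1 combine with the
harmonic number into γ. -/
theorem norm_lambert_ofReal_sub_le {x : ℝ} (hx : 0 < x) :
    ‖lambert x - (Real.eulerMascheroniConstant - Real.log x) / x‖ ≤ 1 := by
  have h1 := (hasSum_lambert_ofReal hx).tendsto_sum_nat.comp (tendsto_add_atTop_nat 1)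
  have h2 : Tendsto (fun M : ℕ ↦ ((harmonic (M + 1) : ℝ) - Real.log ((M + 1 : ℕ) : ℝ) - Real.log x
      + Real.log (1 - Real.exp (-((M + 1) * x)))) / x) atTop
      (𝓝 ((Real.eulerMascheroniConstant - Real.log x) / x)) := by
    have h3 := Real.tendsto_harmonic_sub_log.comp (tendsto_add_atTop_nat 1)
    have h4 : Tendsto (fun M : ℕ ↦ Real.log (1 - Real.exp (-((M + 1) * x)))) atTop (𝓝 0) := by
      have h5 : Tendsto (fun M : ℕ ↦ ((M : ℝ) + 1) * x) atTop atTop :=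
        (tendsto_atTop_add_const_right _ _ tendsto_natCast_atTop_atTop).atTop_mul_const hx
      have h6 := (Real.tendsto_exp_neg_atTop_nhds_zero.comp h5).const_sub 1
      have h7 := (Real.continuousAt_log (x := 1 - 0) (by norm_num)).tendsto.comp h6
      simpa [Function.comp_def] using h7
    have := ((h3.sub_const (Real.log x)).add h4).div_const x
    simpa [Function.comp_def] using this
  have h3 := (continuous_ofReal.tendsto _).comp h2
  have h4 := (h1.sub h3).norm
  rw [show lambert x - (Real.eulerMascheroniConstant - Real.log x) / x = lambert x -
    (((Real.eulerMascheroniConstant - Real.log x) / x : ℝ) : ℂ) by push_cast; rfl]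
  refine le_of_tendsto h4 (.of_forall fun M ↦ ?_)
  simp only [Function.comp_apply]
  rw [← ofReal_sum, ← ofReal_sub, norm_real, Real.norm_eq_abs]
  have hM := abs_sum_bosePsi_sub_le hx M
  have e : ∑ m ∈ Finset.range (M + 1), 1 / (Real.exp ((m + 1) * x) - 1) -
      ((harmonic (M + 1) : ℝ) - Real.log ((M + 1 : ℕ) : ℝ) - Real.log x
      + Real.log (1 - Real.exp (-((M + 1) * x)))) / x =
      -(∑ m ∈ Finset.range (M + 1), x * bosePsi ((m + 1) * x) - bosePhi ((M + 1) * x)) / x := by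
    rw [eq_div_iff hx.ne', sub_mul, div_mul_cancel₀ _ hx.ne', bosePhi,
      Real.log_mul (by positivity) hx.ne', Finset.sum_mul, harmonic]
    have : ∀ m : ℕ, 1 / (Real.exp ((m + 1) * x) - 1) * x =
        ((m : ℝ) + 1)⁻¹ - x * bosePsi ((m + 1) * x) := by
      intro m
      unfold bosePsi
      have : ((m : ℝ) + 1) ≠ 0 := by positivity
      field_simp
      ring
    simp only [this, Finset.sum_sub_distrib]
    push_cast
    ring
  rw [e, abs_div, abs_neg, abs_of_pos hx, div_le_one hx]
  exact hM

/-! ### Mellin transform of the regularised series in the strip 0 < re s < 1. -/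

/-- The function `1 / x` cut off to `(0, 1]`. -/
noncomputable def invLow : ℝ → ℂ := (Ioc (0 : ℝ) 1).indicator fun x ↦ (x : ℂ) ^ (-1 : ℂ)

/-- The function `1 / x` cut off to `(1, ∞)`. -/
noncomputable def invHigh : ℝ → ℂ := (Ioi (1 : ℝ)).indicator fun x ↦ (x : ℂ) ^ (-1 : ℂ)

lemma invLow_add_invHigh {x : ℝ} (hx : 0 < x) : invLow x + invHigh x = 1 / x := by
  rcases le_or_gt x 1 with h | h
  · simp [invLow, invHigh, hx, h, cpow_neg_one, not_lt.2 h]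
  · simp [invLow, invHigh, hx, h, cpow_neg_one, not_le.2 h]

lemma measurable_invLow : Measurable invLow := Measurable.indicator (by fun_prop) measurableSet_Ioc

lemma measurable_invHigh : Measurable invHigh := Measurable.indicator (by fun_prop) measurableSet_Ioi

lemma norm_invLow_le {x : ℝ} : ‖invLow x‖ ≤ ‖x⁻¹‖ := by
  refine (norm_indicator_le_norm_self _ _).trans ?_
  simp [cpow_neg_one]

lemma norm_invHigh_le {x : ℝ} : ‖invHigh x‖ ≤ ‖x⁻¹‖ := by
  refine (norm_indicator_le_norm_self _ _).trans ?_
  simp [cpow_neg_one]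

lemma locallyIntegrableOn_inv : LocallyIntegrableOn (fun x : ℝ ↦ x⁻¹) (Ioi 0) :=
  ContinuousOn.locallyIntegrableOn (continuousOn_inv₀.mono fun _ hx ↦ ne_of_gt hx) measurableSet_Ioi

lemma isBigO_rpow_neg_one {l : Filter ℝ} (hl : ∀ᶠ x in l, 0 < x) {f : ℝ → ℂ}
    (hf : ∀ x, ‖f x‖ ≤ ‖x⁻¹‖) : f =O[l] fun x : ℝ ↦ x ^ (-1 : ℝ) := by
  refine Asymptotics.IsBigO.of_bound 1 ?_
  filter_upwards [hl] with x hx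
  rw [Real.rpow_neg_one, one_mul]
  exact hf x

lemma hasMellin_invLow {s : ℂ} (hs : 1 < s.re) : HasMellin invLow s (1 / (s - 1)) :=
  hasMellin_cpow_Ioc (-1) (by simpa using hs)

/-- A factor log t under the Mellin integral is a derivative in s. -/
lemma hasMellin_log_invLow {s : ℂ} (hs : 1 < s.re) :
    HasMellin (fun t ↦ Real.log t • invLow t) s (-1 / (s - 1) ^ 2) := by
  have h := mellin_hasDerivAt_of_isBigO_rpow (f := invLow) (a := s.re + 1) (b := 1) (s := s)
    (locallyIntegrableOn_inv.mono measurable_invLow.aestronglyMeasurable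
      (.of_forall fun _ ↦ norm_invLow_le)) ?_ (by linarith)
    (isBigO_rpow_neg_one self_mem_nhdsWithin fun _ ↦ norm_invLow_le) hs
  · refine ⟨h.1, h.2.unique ?_⟩
    have hs1 : s - 1 ≠ 0 := by
      intro h; rw [sub_eq_zero] at h; simp [h] at hs
    have hd := ((hasDerivAt_id s).sub_const 1).fun_inv hs1
    refine hd.congr_of_eventuallyEq ?_
    filter_upwards [(isOpen_lt continuous_const continuous_re).mem_nhds
      (show s ∈ {s : ℂ | 1 < s.re} from hs)] with z hz
    rw [(hasMellin_invLow hz).2, one_div]; rfl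
  · refine Asymptotics.IsBigO.of_bound 1 ?_
    filter_upwards [eventually_gt_atTop 1] with x hx
    rw [invLow, indicator_of_notMem (by simp [hx]), norm_zero]
    positivity

lemma hasMellin_invHigh {s : ℂ} (hs : s.re < 1) : HasMellin invHigh s (-1 / (s - 1)) := by
  have h0 : ∀ t ∈ Ioi (1 : ℝ), (t : ℂ) ^ (s - 2) = (t : ℂ) ^ (s - 1) • (t : ℂ) ^ (-1 : ℂ) := by
    intro t ht
    have : (t : ℂ) ≠ 0 := by exact_mod_cast (zero_lt_one.trans ht).ne'
    rw [smul_eq_mul, ← cpow_add _ _ this]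
    ring_nf
  have hlt : (s - 2).re < -1 := by simp; linarith
  have hi := (integrableOn_Ioi_cpow_of_lt hlt one_pos).congr_fun h0 measurableSet_Ioi
  have he := integral_Ioi_cpow_of_lt hlt one_pos
  rw [setIntegral_congr_fun measurableSet_Ioi h0] at he
  simp_rw [HasMellin, mellin, MellinConvergent, invHigh, ← indicator_smul, IntegrableOn,
    integrable_indicator_iff (measurableSet_Ioi (a := (1 : ℝ))),
    integral_indicator (measurableSet_Ioi (a := (1 : ℝ))), IntegrableOn,
    Measure.restrict_restrict_of_subset (Ioi_subset_Ioi zero_le_one)]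
  refine ⟨hi, he.trans ?_⟩
  simp only [ofReal_one, one_cpow]
  ring_nf

lemma hasMellin_log_invHigh {s : ℂ} (hs : s.re < 1) :
    HasMellin (fun t ↦ Real.log t • invHigh t) s (1 / (s - 1) ^ 2) := by
  have h := mellin_hasDerivAt_of_isBigO_rpow (f := invHigh) (a := 1) (b := s.re - 1) (s := s)
    (locallyIntegrableOn_inv.mono measurable_invHigh.aestronglyMeasurable
      (.of_forall fun _ ↦ norm_invHigh_le))
    (isBigO_rpow_neg_one (eventually_gt_atTop 0) fun _ ↦ norm_invHigh_le) hs ?_ (by linarith)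
  · refine ⟨h.1, h.2.unique ?_⟩
    have hs1 : s - 1 ≠ 0 := by
      intro h; rw [sub_eq_zero] at h; simp [h] at hs
    have hd := (((hasDerivAt_id s).sub_const 1).fun_inv hs1).fun_neg
    refine (hd.congr_deriv (by simp; ring)).congr_of_eventuallyEq ?_
    filter_upwards [(isOpen_lt continuous_re continuous_const).mem_nhds
      (show s ∈ {s : ℂ | s.re < 1} from hs)] with z hz
    rw [(hasMellin_invHigh hz).2, neg_div, one_div]; rfl
  · refine Asymptotics.IsBigO.of_bound 1 ?_
    filter_upwards [Ioo_mem_nhdsGT one_pos] with x hx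
    rw [invHigh, indicator_of_notMem (by simp [hx.2.le]), norm_zero]
    have := hx.1
    positivity

lemma continuousOn_lambert_ofReal : ContinuousOn (fun x : ℝ ↦ lambert x) (Ioi 0) := fun x hx ↦
  ((differentiableAt_lambert (z := x) (by simpa using hx)).continuousAt.comp
    continuous_ofReal.continuousAt).continuousWithinAt

lemma isBigO_lambert {a : ℝ} (ha : 1 < a) {l : Filter ℝ} (hl : ∀ᶠ x in l, 0 < x) :
    (fun x : ℝ ↦ lambert x) =O[l] fun x : ℝ ↦ x ^ (-a) := by
  obtain ⟨C, hC⟩ := exists_norm_lambert_le ha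
  refine Asymptotics.IsBigO.of_bound C ?_
  filter_upwards [hl] with x hx
  have := hC x (by simpa using hx)
  rw [ofReal_re] at this
  rwa [Real.norm_of_nonneg (by positivity)]

lemma mellinConvergent_lambert {s : ℂ} (hs : 1 < s.re) :
    MellinConvergent (fun x : ℝ ↦ lambert x) s :=
  mellinConvergent_of_isBigO_rpow (a := s.re + 1) (b := (1 + s.re) / 2)
    (continuousOn_lambert_ofReal.locallyIntegrableOn measurableSet_Ioi)
    (isBigO_lambert (by linarith) (eventually_gt_atTop 0)) (by linarith)
    (isBigO_lambert (by linarith) self_mem_nhdsWithin) (by linarith)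

/-- The singular part of the Lambert series, cut off to `(0, 1]`. -/
noncomputable def singularLow (x : ℝ) : ℂ :=
  (Real.eulerMascheroniConstant : ℂ) • invLow x - Real.log x • invLow x

/-- The singular part of the Lambert series, cut off to `(1, ∞)`. -/
noncomputable def singularHigh (x : ℝ) : ℂ :=
  (Real.eulerMascheroniConstant : ℂ) • invHigh x - Real.log x • invHigh x

lemma hasMellin_singularLow {s : ℂ} (hs : 1 < s.re) :
    HasMellin singularLow s (Real.eulerMascheroniConstant / (s - 1) + 1 / (s - 1) ^ 2) := by
  have h := hasMellin_sub
    (hasMellin_const_smul (hasMellin_invLow hs).1 (Real.eulerMascheroniConstant : ℂ)).1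
    (hasMellin_log_invLow hs).1
  refine ⟨h.1, h.2.trans ?_⟩
  rw [mellin_const_smul, (hasMellin_invLow hs).2, (hasMellin_log_invLow hs).2, smul_eq_mul]
  ring

lemma hasMellin_singularHigh {s : ℂ} (hs : s.re < 1) :
    HasMellin singularHigh s (-Real.eulerMascheroniConstant / (s - 1) - 1 / (s - 1) ^ 2) := by
  have h := hasMellin_sub
    (hasMellin_const_smul (hasMellin_invHigh hs).1 (Real.eulerMascheroniConstant : ℂ)).1
    (hasMellin_log_invHigh hs).1
  refine ⟨h.1, h.2.trans ?_⟩
  rw [mellin_const_smul, (hasMellin_invHigh hs).2, (hasMellin_log_invHigh hs).2, smul_eq_mul]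
  ring

/-- The Lambert series minus its singular part on `(0, 1]`. -/
noncomputable def lambertLow (x : ℝ) : ℂ := lambert x - singularLow x

lemma locallyIntegrableOn_lambertLow : LocallyIntegrableOn lambertLow (Ioi 0) := by
  refine (continuousOn_lambert_ofReal.locallyIntegrableOn measurableSet_Ioi).sub ?_
  have h1 : LocallyIntegrableOn (fun x ↦ (|Real.eulerMascheroniConstant| + |Real.log x|) * x⁻¹)
      (Ioi 0) := by
    refine ContinuousOn.locallyIntegrableOn ?_ measurableSet_Ioi
    refine ContinuousOn.mul (continuousOn_const.add (ContinuousOn.abs ?_)) ?_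
    · exact Real.continuousOn_log.mono fun x hx ↦ ne_of_gt hx
    · exact continuousOn_inv₀.mono fun _ hx ↦ ne_of_gt hx
  refine h1.mono ?_ (.of_forall fun x ↦ ?_)
  · refine Measurable.aestronglyMeasurable (Measurable.sub ?_ ?_)
    · exact measurable_invLow.const_smul (Real.eulerMascheroniConstant : ℂ)
    · exact Real.measurable_log.smul measurable_invLow
  · refine (norm_sub_le _ _).trans ?_
    have := norm_invLow_le (x := x)
    rw [norm_smul, norm_smul, norm_real, norm_mul, Real.norm_eq_abs, Real.norm_eq_abs, ← add_mul,
      Real.norm_of_nonneg (by positivity : 0 ≤ |Real.eulerMascheroniConstant| + |Real.log x|)]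
    gcongr

lemma isBigO_lambertLow_atTop {a : ℝ} (ha : 1 < a) :
    lambertLow =O[atTop] fun x : ℝ ↦ x ^ (-a) := by
  refine (isBigO_lambert ha (eventually_gt_atTop 0)).congr' ?_ .rfl
  filter_upwards [eventually_gt_atTop 1] with x hx
  simp [lambertLow, singularLow, invLow, not_le.2 hx]

lemma isBigO_lambertLow_zero : lambertLow =O[𝓝[>] 0] fun x : ℝ ↦ x ^ (-0 : ℝ) := by
  refine Asymptotics.IsBigO.of_bound 1 ?_
  filter_upwards [Ioo_mem_nhdsGT one_pos] with x hx
  have h := norm_lambert_ofReal_sub_le hx.1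
  have e : lambertLow x = lambert x - (Real.eulerMascheroniConstant - Real.log x) / x := by
    rw [lambertLow, singularLow, invLow, indicator_of_mem (show x ∈ Ioc (0 : ℝ) 1 from ⟨hx.1, hx.2.le⟩), cpow_neg_one]
    simp only [smul_eq_mul, real_smul]
    ring
  rw [e]
  simpa using h

lemma mellinConvergent_lambertLow {s : ℂ} (hs : 0 < s.re) : MellinConvergent lambertLow s :=
  mellinConvergent_of_isBigO_rpow locallyIntegrableOn_lambertLow
    (isBigO_lambertLow_atTop (a := s.re + 2) (by linarith)) (by linarith)
    isBigO_lambertLow_zero hs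

lemma differentiableAt_mellin_lambertLow {s : ℂ} (hs : 0 < s.re) :
    DifferentiableAt ℂ (mellin lambertLow) s :=
  mellin_differentiableAt_of_isBigO_rpow locallyIntegrableOn_lambertLow
    (isBigO_lambertLow_atTop (a := s.re + 2) (by linarith)) (by linarith)
    isBigO_lambertLow_zero hs

/-- Below re s = 1 the formula is a continuation: the factor (s − 1)² clears the double pole of ζ²,
so both sides become holomorphic for re s > 0 and agree for re s > 1. -/
lemma mellin_lambertLow {s : ℂ} (hs : 0 < s.re) (hs1 : s ≠ 1) :
    mellin lambertLow s = Gamma s * riemannZeta s ^ 2 -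
      (Real.eulerMascheroniConstant / (s - 1) + 1 / (s - 1) ^ 2) := by
  have hs1' : s - 1 ≠ 0 := sub_ne_zero.2 hs1
  have key := eq_of_eqOn_one_lt_re (s := s)
    (f := fun s ↦ (s - 1) ^ 2 * mellin lambertLow s + (Real.eulerMascheroniConstant * (s - 1) + 1))
    (g := fun s ↦ Gamma s * riemannZeta₁ s ^ 2)
    (fun s hs ↦ ?_) (fun s hs ↦ ?_) (fun s hs ↦ ?_) hs
  · rw [riemannZeta_eq_inv_sub_mul hs1]
    field_simp
    linear_combination key
  · have := differentiableAt_mellin_lambertLow hs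
    fun_prop
  · have := differentiableAt_Gamma s fun m h ↦ by
      rw [h] at hs
      simp at hs
      linarith [(Nat.cast_nonneg m : (0 : ℝ) ≤ m)]
    have := differentiable_riemannZeta₁ s
    fun_prop
  · have hne : s ≠ 1 := by rintro rfl; simp at hs
    have hne' : s - 1 ≠ 0 := sub_ne_zero.2 hne
    have h := (hasMellin_sub (mellinConvergent_lambert hs) (hasMellin_singularLow hs).1).2
    rw [mellin_lambert hs, (hasMellin_singularLow hs).2, riemannZeta_eq_inv_sub_mul hne] at h
    change mellin lambertLow s = _ at h
    simp only [h]
    field_simp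
    ring

/-- The Lambert series minus its singular part at the origin. -/
noncomputable def lambertReg (x : ℝ) : ℂ :=
  lambert x - (Real.eulerMascheroniConstant - Real.log x) / x

lemma lambertReg_eq {x : ℝ} (hx : 0 < x) : lambertReg x = lambertLow x - singularHigh x := by
  rw [lambertReg, lambertLow, singularLow, singularHigh, div_eq_mul_one_div,
    ← invLow_add_invHigh hx]
  simp only [smul_eq_mul, real_smul]
  ring

/-- The two halves of the singular part have opposite transforms as rational functions, although
they converge on opposite sides of re s = 1. Subtracting the second half therefore cancels the polar
terms left by the first. -/
theorem hasMellin_lambertReg {s : ℂ} (h0 : 0 < s.re) (h1 : s.re < 1) :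
    HasMellin lambertReg s (Gamma s * riemannZeta s ^ 2) := by
  have hs1 : s ≠ 1 := by rintro rfl; simp at h1
  have h := hasMellin_sub (mellinConvergent_lambertLow h0) (hasMellin_singularHigh h1).1
  have e : ∀ x ∈ Ioi (0 : ℝ), (x : ℂ) ^ (s - 1) • (lambertLow x - singularHigh x) =
      (x : ℂ) ^ (s - 1) • lambertReg x := fun x hx ↦ by rw [lambertReg_eq hx]
  refine ⟨h.1.congr_fun e measurableSet_Ioi, ?_⟩
  rw [mellin, ← setIntegral_congr_fun measurableSet_Ioi e]
  refine h.2.trans ?_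
  rw [mellin_lambertLow h0 hs1, (hasMellin_singularHigh h1).2]
  ring

/-! ### The kernel on the critical line and the functional equation. -/

/-- The square `|ζ(1/2 + it)|²`. -/
noncomputable def zetaSq (t : ℝ) : ℝ := ‖riemannZeta (1 / 2 + t * I)‖ ^ 2

/-- The kernel `|ζ(s)|² / (2 cos (π s / 2))` on the critical line. -/
noncomputable def critKernel (t : ℝ) : ℂ := zetaSq t / (2 * cos (π * (1 / 2 + t * I) / 2))

lemma half_add_ne_one (t : ℝ) : (1 / 2 + (t : ℂ) * I) ≠ 1 := by
  intro h
  have := congrArg re h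
  simp at this

lemma continuous_zetaSq : Continuous zetaSq := by
  unfold zetaSq
  refine (Continuous.norm ?_).pow 2
  refine continuous_iff_continuousAt.2 fun t ↦ ?_
  exact ContinuousAt.comp (f := fun t : ℝ ↦ (1 / 2 + (t : ℂ) * I)) (g := riemannZeta)
    (differentiableAt_riemannZeta (half_add_ne_one t)).continuousAt
    (Continuous.continuousAt (by fun_prop))

lemma zetaSq_nonneg (t : ℝ) : 0 ≤ zetaSq t := sq_nonneg _

lemma conj_half_add (t : ℝ) :
    (starRingEnd ℂ) (1 / 2 + t * I) = 1 - (1 / 2 + t * I) := by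
  apply Complex.ext
  · simp; norm_num
  · simp

lemma zetaSq_neg (t : ℝ) : zetaSq (-t) = zetaSq t := by
  unfold zetaSq
  have : (1 / 2 + ((-t : ℝ) : ℂ) * I) = (starRingEnd ℂ) (1 / 2 + t * I) := by
    rw [conj_half_add]; push_cast; ring
  rw [this, riemannZeta_conj, norm_conj]

lemma zetaSq_le (t : ℝ) : zetaSq t ≤ 4 * (1 + |t|) ^ 2 := by
  have := norm_riemannZeta_half_le t
  unfold zetaSq
  calc _ ≤ (2 + 2 * |t|) ^ 2 := by gcongr
    _ = _ := by ring

lemma integrable_exp_neg_mul_abs {c : ℝ} (hc : 0 < c) :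
    Integrable fun t : ℝ ↦ Real.exp (-c * |t|) := by
  rw [← integrableOn_univ, ← Iic_union_Ioi (a := (0 : ℝ)), integrableOn_union]
  constructor
  · refine (integrableOn_exp_mul_Iic hc 0).congr_fun (fun t ht ↦ ?_) measurableSet_Iic
    simp only
    rw [abs_of_nonpos ht]; ring_nf
  · refine (integrableOn_exp_mul_Ioi (neg_lt_zero.2 hc) 0).congr_fun (fun t ht ↦ ?_) measurableSet_Ioi
    simp only
    rw [abs_of_pos ht]

lemma one_add_pow_le_exp {c u : ℝ} (hc : 0 < c) (hu : 0 ≤ u) (k : ℕ) :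
    (1 + u) ^ k ≤ c⁻¹ ^ k * Real.exp (k * c) * Real.exp (k * c * u) := by
  have h : c * (1 + u) ≤ Real.exp (c * (1 + u)) := by
    linarith [Real.add_one_le_exp (c * (1 + u))]
  have h2 := pow_le_pow_left₀ (by positivity) h k
  rw [← Real.exp_nat_mul, mul_pow] at h2
  calc (1 + u) ^ k = c⁻¹ ^ k * (c ^ k * (1 + u) ^ k) := by
        rw [inv_pow]; field_simp
    _ ≤ c⁻¹ ^ k * Real.exp (k * (c * (1 + u))) := by gcongr
    _ = _ := by rw [mul_assoc, ← Real.exp_add]; ring_nf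

lemma integrable_one_add_abs_pow_mul_exp {c : ℝ} (hc : 0 < c) (k : ℕ) :
    Integrable fun t : ℝ ↦ (1 + |t|) ^ k * Real.exp (-c * |t|) := by
  -- With this rate the k-th power costs at most exp(c|t|/2), which leaves half of the decay.
  have hd : 0 < c / (2 * (k + 1)) := by positivity
  refine ((integrable_exp_neg_mul_abs (half_pos hc)).const_mul
    ((c / (2 * (k + 1)))⁻¹ ^ k * Real.exp (k * (c / (2 * (k + 1)))))).mono'
    (Continuous.aestronglyMeasurable (by fun_prop)) (.of_forall fun t ↦ ?_)
  rw [Real.norm_of_nonneg (by positivity)]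
  have h := one_add_pow_le_exp hd (abs_nonneg t) k
  calc _ ≤ _ := mul_le_mul_of_nonneg_right h (Real.exp_pos _).le
    _ ≤ _ := ?_
  rw [mul_assoc, ← Real.exp_add]
  gcongr
  have : k * (c / (2 * (k + 1))) ≤ c / 2 := by
    rw [mul_div_assoc', div_le_div_iff₀ (by positivity) (by positivity)]
    nlinarith
  nlinarith [abs_nonneg t]

lemma integrable_pow_mul_zetaSq_mul_exp {c : ℝ} (hc : 0 < c) (k : ℕ) :
    Integrable fun t : ℝ ↦ (1 + |t|) ^ k * (zetaSq t * Real.exp (-c * |t|)) := by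
  refine ((integrable_one_add_abs_pow_mul_exp hc (k + 2)).const_mul 4).mono'
    (Continuous.aestronglyMeasurable ?_) (.of_forall fun t ↦ ?_)
  · have := continuous_zetaSq
    fun_prop
  · have h0 := zetaSq_nonneg t
    rw [Real.norm_of_nonneg (by positivity)]
    calc (1 + |t|) ^ k * (zetaSq t * Real.exp (-c * |t|))
        ≤ (1 + |t|) ^ k * (4 * (1 + |t|) ^ 2 * Real.exp (-c * |t|)) := by
          gcongr; exact zetaSq_le t
      _ = _ := by ring

lemma integrable_zetaSq_mul_exp {c : ℝ} (hc : 0 < c) :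
    Integrable fun t : ℝ ↦ zetaSq t * Real.exp (-c * |t|) := by
  simpa using integrable_pow_mul_zetaSq_mul_exp hc 0

/-- The exponential dominant as t → +∞ is factored out; the remaining factor 1 + i exp(−πt) has
modulus at least max(1, exp(−πt)), hence no zeros, and it tends to 1 exponentially fast. -/
lemma two_mul_cos_eq (t : ℝ) : 2 * cos (π * (1 / 2 + t * I) / 2) =
    cexp (-(π / 4) * I) * cexp (π * t / 2) * (1 + I * cexp (-(π * t))) := by
  have h1 : cexp (-(π / 4) * I) * cexp (π * t / 2) =
      cexp (-(π * (1 / 2 + t * I) / 2) * I) := by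
    rw [← exp_add]
    congr 1
    linear_combination (π * t / 2 : ℂ) * I_mul_I
  have h2 : cexp (-(π / 4) * I) * cexp (π * t / 2) * (I * cexp (-(π * t))) =
      cexp (π * (1 / 2 + t * I) / 2 * I) := by
    have hI : I * cexp (-(π * t)) = cexp (π / 2 * I + -(π * t)) := by
      rw [exp_add, exp_pi_div_two_mul_I]
    rw [hI, ← exp_add, ← exp_add]
    congr 1
    linear_combination (-(π * t / 2) : ℂ) * I_mul_I
  rw [cos, mul_div_cancel₀ _ (two_ne_zero' ℂ), mul_add (_ * _) 1, h2, mul_one, h1, add_comm]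

lemma norm_one_add_I_mul_exp (x : ℝ) :
    1 ≤ ‖1 + I * cexp (x : ℂ)‖ ∧ Real.exp x ≤ ‖1 + I * cexp (x : ℂ)‖ := by
  rw [← ofReal_exp]
  constructor
  · refine le_trans ?_ (abs_re_le_norm _); simp
  · refine le_trans ?_ (abs_im_le_norm _)
    rw [add_im, one_im, I_mul_im, ofReal_re, zero_add]
    exact le_abs_self _

lemma exp_le_norm_two_mul_cos (t : ℝ) :
    Real.exp (π / 2 * |t|) ≤ ‖2 * cos (π * (1 / 2 + t * I) / 2)‖ := by
  have h1 : ‖cexp (-(π / 4) * I)‖ = 1 := by rw [norm_exp]; simp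
  have h2 : ‖cexp (π * t / 2)‖ = Real.exp (π / 2 * t) := by
    rw [norm_exp]; congr 1; norm_cast; ring
  have h3 := norm_one_add_I_mul_exp (-(π * t))
  push_cast at h3
  rw [two_mul_cos_eq, norm_mul, norm_mul, h1, h2, one_mul]
  rcases le_total 0 t with ht | ht
  · rw [abs_of_nonneg ht]
    exact le_mul_of_one_le_right (Real.exp_pos _).le h3.1
  · rw [abs_of_nonpos ht]
    calc Real.exp (π / 2 * -t) = Real.exp (π / 2 * t) * Real.exp (-(π * t)) := by
          rw [← Real.exp_add]; ring_nf
      _ ≤ _ := by gcongr; exact h3.2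

lemma two_mul_cos_ne_zero (t : ℝ) : 2 * cos (π * (1 / 2 + t * I) / 2) ≠ 0 := by
  rw [← norm_pos_iff]
  exact (Real.exp_pos _).trans_le (exp_le_norm_two_mul_cos t)

lemma continuous_critKernel : Continuous critKernel := by
  unfold critKernel
  refine Continuous.div (continuous_ofReal.comp continuous_zetaSq) (by fun_prop) two_mul_cos_ne_zero

lemma norm_critKernel_le (t : ℝ) : ‖critKernel t‖ ≤ zetaSq t * Real.exp (-(π / 2) * |t|) := by
  have h0 := zetaSq_nonneg t
  rw [critKernel, norm_div, norm_real, Real.norm_of_nonneg h0, div_eq_mul_inv, neg_mul,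
    Real.exp_neg]
  gcongr
  exact exp_le_norm_two_mul_cos t

lemma Gamma_mul_zeta_sq (t : ℝ) : Gamma (1 / 2 + t * I) * riemannZeta (1 / 2 + t * I) ^ 2 =
    (2 * π : ℂ) ^ (1 / 2 + t * I) * critKernel t := by
  set s : ℂ := 1 / 2 + t * I with hs
  have hre : s.re = 1 / 2 := by simp [hs]
  have hfe := riemannZeta_one_sub (s := s)
    (fun n h ↦ by
      have h2 := congrArg re h
      rw [hre] at h2
      simp at h2
      linarith [(Nat.cast_nonneg n : (0 : ℝ) ≤ n)]) (half_add_ne_one t)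
  have hZ : (zetaSq t : ℂ) = riemannZeta s * riemannZeta (1 - s) := by
    rw [← conj_half_add, riemannZeta_conj, mul_conj, normSq_eq_norm_sq]
    rfl
  have hpi : (2 * π : ℂ) ≠ 0 := by exact_mod_cast Real.two_pi_pos.ne'
  have hp : (2 * π : ℂ) ^ s * (2 * π : ℂ) ^ (-s) = 1 := by
    rw [← cpow_add _ _ hpi]; simp
  have hc := two_mul_cos_ne_zero t
  rw [← hs] at hc
  rw [critKernel, ← hs, hZ, hfe, mul_div_assoc', eq_div_iff hc]
  linear_combination (-Gamma s * riemannZeta s ^ 2 * (2 * cos (π * s / 2))) * hp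

/-! ### Mellin inversion and continuation to a strip. -/

lemma continuousOn_lambertReg : ContinuousOn lambertReg (Ioi 0) := by
  refine continuousOn_lambert_ofReal.sub (ContinuousOn.div (continuousOn_const.sub ?_)
    continuous_ofReal.continuousOn fun x hx ↦ ofReal_ne_zero.2 (ne_of_gt hx))
  exact continuous_ofReal.comp_continuousOn (Real.continuousOn_log.mono fun x hx ↦ ne_of_gt hx)

lemma norm_two_pi_cpow (t : ℝ) : ‖(2 * π : ℂ) ^ (1 / 2 + t * I)‖ = (2 * π) ^ (1 / 2 : ℝ) := by
  have := norm_cpow_eq_rpow_re_of_pos Real.two_pi_pos (1 / 2 + t * I)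
  push_cast at this
  rw [this]; simp

lemma verticalIntegrable_mellin_lambertReg : VerticalIntegrable (mellin lambertReg) (1 / 2) := by
  unfold VerticalIntegrable
  have e : (fun y : ℝ ↦ mellin lambertReg ((1 / 2 : ℝ) + y * I)) =
      fun y : ℝ ↦ (2 * π : ℂ) ^ (1 / 2 + y * I) * critKernel y := by
    ext y
    rw [← Gamma_mul_zeta_sq]
    push_cast
    exact (hasMellin_lambertReg (by simp) (by simp; norm_num)).2
  rw [e]
  have hpi : (2 * π : ℂ) ≠ 0 := by exact_mod_cast Real.two_pi_pos.ne'
  refine ((integrable_zetaSq_mul_exp (c := π / 2) (by positivity)).const_mul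
    ((2 * π) ^ (1 / 2 : ℝ))).mono' (Continuous.aestronglyMeasurable ?_) (.of_forall fun t ↦ ?_)
  · have := continuous_critKernel
    refine Continuous.mul (Continuous.const_cpow (by fun_prop) (Or.inl hpi)) this
  · rw [norm_mul, norm_two_pi_cpow]
    gcongr
    exact norm_critKernel_le t

/-- Mellin inversion on re s = 1/2. Evaluating at 2π exp y rather than at exp y absorbs the factor
(2π)^s. -/
lemma lambertReg_eq_integral (y : ℝ) : lambertReg (2 * π * Real.exp y) =
    1 / (2 * π) * ∫ t : ℝ, cexp (-(y : ℂ) * (1 / 2 + t * I)) * critKernel t := by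
  have hx : 0 < 2 * π * Real.exp y := by positivity
  have hpi : (2 * π : ℂ) ≠ 0 := by exact_mod_cast Real.two_pi_pos.ne'
  rw [← mellinInv_mellin_eq (1 / 2) lambertReg hx (hasMellin_lambertReg (by simp)
    (by simp; norm_num)).1 verticalIntegrable_mellin_lambertReg
    (continuousOn_lambertReg.continuousAt (Ioi_mem_nhds hx)), mellinInv, real_smul]
  congr 1
  · push_cast; rfl
  congr 1
  ext t
  have h := (hasMellin_lambertReg (s := 1 / 2 + t * I) (by simp) (by simp; norm_num)).2
  rw [Gamma_mul_zeta_sq] at h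
  push_cast
  rw [h, smul_eq_mul, ← mul_assoc]
  congr 1
  have h1 := mul_cpow_ofReal_nonneg (Real.two_pi_pos.le) (Real.exp_pos y).le (-(1 / 2 + t * I))
  push_cast at h1
  rw [h1, mul_right_comm, ← cpow_add _ _ hpi, neg_add_cancel, cpow_zero, one_mul, ← ofReal_exp,
    cpow_def_of_ne_zero (ofReal_ne_zero.2 (Real.exp_pos y).ne'), ← ofReal_log (Real.exp_pos y).le,
    Real.log_exp]
  ring_nf

/-- The regularised Lambert series at `2π exp y`, for complex `y`. -/
noncomputable def lambertStrip (y : ℂ) : ℂ := lambert (2 * π * cexp y) -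
  (Real.eulerMascheroniConstant - (Real.log (2 * π) + y)) / (2 * π * cexp y)

lemma norm_critKernel_mul_exp_le (y : ℂ) (t : ℝ) :
    ‖cexp (-y * (1 / 2 + t * I)) * critKernel t‖ ≤
      Real.exp (-y.re / 2) * (zetaSq t * Real.exp (-(π / 2) * |t| + y.im * t)) := by
  have h : ‖cexp (-y * (1 / 2 + t * I))‖ = Real.exp (-y.re / 2) * Real.exp (y.im * t) := by
    rw [norm_exp, ← Real.exp_add]
    congr 1
    simp
    ring
  rw [norm_mul, h, Real.exp_add]
  have := norm_critKernel_le t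
  calc _ ≤ Real.exp (-y.re / 2) * Real.exp (y.im * t) * (zetaSq t * Real.exp (-(π / 2) * |t|)) := by
        gcongr
    _ = _ := by ring

lemma differentiableAt_integral_critKernel {y : ℂ} (hy : |y.im| < π / 2) :
    DifferentiableAt ℂ
      (fun y : ℂ ↦ ∫ t : ℝ, cexp (-y * (1 / 2 + t * I)) * critKernel t) y := by
  -- Half the distance to the edge of the strip: on the ball of radius r the integrand still decays
  -- like exp(−r|t|).
  set r := (π / 2 - |y.im|) / 2 with hr
  have hr0 : 0 < r := by rw [hr]; linarith
  have hK := continuous_critKernel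
  have hbound : ∀ x ∈ Metric.ball y r, ∀ t : ℝ, ‖cexp (-x * (1 / 2 + t * I)) * critKernel t‖ ≤
      Real.exp ((|y.re| + r) / 2) * (zetaSq t * Real.exp (-r * |t|)) := by
    intro x hx t
    have hx' : ‖x - y‖ < r := by simpa [dist_eq_norm] using hx
    have h1 : |x.re - y.re| < r := (abs_re_le_norm (x - y)).trans_lt hx'
    have h2 : |x.im - y.im| < r := (abs_im_le_norm (x - y)).trans_lt hx'
    have h3 : |x.im| ≤ |y.im| + r := by
      have := abs_sub_abs_le_abs_sub x.im y.im
      linarith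
    have h4 : -x.re ≤ |y.re| + r := by
      have := (abs_lt.1 h1).1
      have := neg_abs_le y.re
      linarith
    refine (norm_critKernel_mul_exp_le x t).trans ?_
    have h0 := zetaSq_nonneg t
    gcongr
    have : x.im * t ≤ |x.im| * |t| := (le_abs_self _).trans_eq (abs_mul _ _)
    nlinarith [abs_nonneg t]
  have hmeas : ∀ x : ℂ, AEStronglyMeasurable
      (fun t : ℝ ↦ cexp (-x * (1 / 2 + t * I)) * critKernel t) := fun x ↦
    Continuous.aestronglyMeasurable (by fun_prop)
  refine (hasDerivAt_integral_of_dominated_loc_of_deriv_le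
    (F := fun (y : ℂ) (t : ℝ) ↦ cexp (-y * (1 / 2 + t * I)) * critKernel t)
    (F' := fun (y : ℂ) (t : ℝ) ↦
      -(1 / 2 + t * I) * (cexp (-y * (1 / 2 + t * I)) * critKernel t)) (x₀ := y)
    (bound := fun t ↦ Real.exp ((|y.re| + r) / 2) *
      ((1 + |t|) ^ 1 * (zetaSq t * Real.exp (-r * |t|))))
    (Metric.ball_mem_nhds y hr0) (.of_forall hmeas)
    ?_ ?_ ?_ ((integrable_pow_mul_zetaSq_mul_exp hr0 1).const_mul _) ?_).2.differentiableAt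
  · exact ((integrable_zetaSq_mul_exp hr0).const_mul _).mono' (hmeas y)
      (.of_forall (hbound y (Metric.mem_ball_self hr0)))
  · exact Continuous.aestronglyMeasurable (by fun_prop)
  · refine .of_forall fun t x hx ↦ ?_
    rw [norm_mul]
    have h1 : ‖-(1 / 2 + (t : ℂ) * I)‖ ≤ 1 + |t| := by
      rw [norm_neg]
      refine (norm_add_le _ _).trans ?_
      simp
      norm_num
    calc _ ≤ (1 + |t|) * (Real.exp ((|y.re| + r) / 2) * (zetaSq t * Real.exp (-r * |t|))) :=
          mul_le_mul h1 (hbound x hx t) (norm_nonneg _) (by positivity)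
      _ = _ := by ring
  · refine .of_forall fun t x _ ↦ ?_
    have h1 : HasDerivAt (fun x : ℂ ↦ -x * (1 / 2 + t * I)) (-(1 / 2 + t * I)) x := by
      simpa using (hasDerivAt_neg x).mul_const (1 / 2 + (t : ℂ) * I)
    refine (h1.cexp.mul_const (critKernel t)).congr_deriv ?_
    ring

lemma re_two_pi_exp_pos {y : ℂ} (hy : |y.im| < π / 2) : 0 < (2 * π * cexp y).re := by
  have h : (2 * π * cexp y).re = 2 * π * (Real.exp y.re * Real.cos y.im) := by
    rw [← exp_re, ← re_ofReal_mul]; push_cast; rfl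
  rw [h]
  have := Real.cos_pos_of_mem_Ioo (abs_lt.1 hy)
  positivity

lemma differentiableAt_lambertStrip {y : ℂ} (hy : |y.im| < π / 2) :
    DifferentiableAt ℂ lambertStrip y := by
  have hpi : (2 * π : ℂ) ≠ 0 := by exact_mod_cast Real.two_pi_pos.ne'
  have h1 : DifferentiableAt ℂ (fun y ↦ lambert (2 * π * cexp y)) y :=
    DifferentiableAt.comp (g := lambert) (f := fun y ↦ 2 * π * cexp y) y
      (differentiableAt_lambert (re_two_pi_exp_pos hy)) (by fun_prop)
  refine h1.sub (DifferentiableAt.div (by fun_prop) (by fun_prop) ?_)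
  exact mul_ne_zero hpi (exp_ne_zero _)

/-- Both sides are holomorphic in the convex strip and agree on the real axis, which accumulates at
0. -/
theorem lambertStrip_eq_integral {y : ℂ} (hy : |y.im| < π / 2) : lambertStrip y =
    1 / (2 * π) * ∫ t : ℝ, cexp (-y * (1 / 2 + t * I)) * critKernel t := by
  have hset : {y : ℂ | |y.im| < π / 2} = im ⁻¹' Ioo (-(π / 2)) (π / 2) := by
    ext y; simp [abs_lt]
  have hU : IsOpen {y : ℂ | |y.im| < π / 2} :=
    isOpen_lt (continuous_abs.comp continuous_im) continuous_const
  have hconv : Convex ℝ {y : ℂ | |y.im| < π / 2} := by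
    rw [hset]
    exact (convex_Ioo _ _).linear_preimage imLm
  have hf : AnalyticOnNhd ℂ lambertStrip {y : ℂ | |y.im| < π / 2} :=
    DifferentiableOn.analyticOnNhd
      (fun y hy ↦ (differentiableAt_lambertStrip hy).differentiableWithinAt) hU
  have hg : AnalyticOnNhd ℂ
      (fun y ↦ 1 / (2 * π) * ∫ t : ℝ, cexp (-y * (1 / 2 + t * I)) * critKernel t)
      {y : ℂ | |y.im| < π / 2} :=
    DifferentiableOn.analyticOnNhd (fun y hy ↦
      ((differentiableAt_integral_critKernel hy).const_mul _).differentiableWithinAt) hU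
  refine hf.eqOn_of_preconnected_of_frequently_eq hg hconv.isPreconnected (z₀ := 0)
    (by simp; positivity) ?_ hy
  have ht : Tendsto (fun x : ℝ ↦ (x : ℂ)) (𝓝[≠] 0) (𝓝[≠] 0) := by
    refine tendsto_nhdsWithin_iff.2 ⟨?_, ?_⟩
    · exact (continuous_ofReal.tendsto' 0 0 (by simp)).mono_left nhdsWithin_le_nhds
    · filter_upwards [self_mem_nhdsWithin] with x hx
      simpa using hx
  refine ht.frequently (Eventually.frequently (.of_forall fun x ↦ ?_))
  rw [← lambertReg_eq_integral, lambertReg, lambertStrip,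
    Real.log_mul Real.two_pi_pos.ne' (Real.exp_pos x).ne', Real.log_exp]
  push_cast
  rfl

/-! ### The Laplace transform of |ζ|² as a boundary value of the Lambert series. -/

/-- The Laplace transform of `|ζ(1/2 + it)|²`. -/
noncomputable def zetaLaplace (w : ℂ) : ℂ := ∫ t in Ioi (0 : ℝ), (zetaSq t : ℂ) * cexp (-w * t)

/-- The Laplace transform of `|ζ(1/2 + it)|²` at real arguments. -/
noncomputable def zetaLaplaceReal (θ : ℝ) : ℝ := ∫ t in Ioi (0 : ℝ), zetaSq t * Real.exp (-θ * t)

lemma zetaSq_abs (t : ℝ) : zetaSq |t| = zetaSq t := by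
  rcases abs_choice t with h | h
  · rw [h]
  · rw [h, zetaSq_neg]

lemma integral_zetaSq_mul_exp_neg_abs (c : ℝ) :
    ∫ t : ℝ, zetaSq t * Real.exp (-c * |t|) = 2 * zetaLaplaceReal c := by
  rw [zetaLaplaceReal, ← integral_comp_abs (f := fun t ↦ zetaSq t * Real.exp (-c * t))]
  simp only [zetaSq_abs]

lemma integrableOn_zetaSq_mul_exp {c : ℝ} (hc : 0 < c) :
    IntegrableOn (fun t ↦ zetaSq t * Real.exp (-c * t)) (Ioi 0) := by
  refine (integrable_zetaSq_mul_exp hc).integrableOn.congr_fun (fun t ht ↦ ?_) measurableSet_Ioi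
  simp only
  rw [abs_of_pos ht]

lemma integrableOn_zetaSq_mul_cexp {w : ℂ} (hw : 0 < w.re) :
    IntegrableOn (fun t : ℝ ↦ (zetaSq t : ℂ) * cexp (-w * t)) (Ioi 0) := by
  refine (integrableOn_zetaSq_mul_exp hw).mono' (Continuous.aestronglyMeasurable ?_)
    (.of_forall fun t ↦ ?_)
  · have := continuous_zetaSq
    fun_prop
  · rw [norm_mul, norm_real, Real.norm_of_nonneg (zetaSq_nonneg t), norm_exp]
    simp

lemma zetaLaplaceReal_nonneg (θ : ℝ) : 0 ≤ zetaLaplaceReal θ :=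
  integral_nonneg fun t ↦ mul_nonneg (zetaSq_nonneg t) (Real.exp_pos _).le

lemma zetaLaplaceReal_anti {a b : ℝ} (ha : 0 < a) (hab : a ≤ b) :
    zetaLaplaceReal b ≤ zetaLaplaceReal a := by
  refine setIntegral_mono_on (integrableOn_zetaSq_mul_exp (ha.trans_le hab))
    (integrableOn_zetaSq_mul_exp ha) measurableSet_Ioi fun t (ht : 0 < t) ↦ ?_
  have := zetaSq_nonneg t
  gcongr

lemma norm_zetaLaplace_le (w : ℂ) : ‖zetaLaplace w‖ ≤ zetaLaplaceReal w.re := by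
  refine (norm_integral_le_integral_norm _).trans_eq ?_
  refine integral_congr_ae (.of_forall fun t ↦ ?_)
  simp only
  rw [norm_mul, norm_real, Real.norm_of_nonneg (zetaSq_nonneg t), norm_exp]
  simp

lemma zetaLaplace_ofReal (θ : ℝ) : zetaLaplace θ = zetaLaplaceReal θ := by
  rw [zetaLaplace, zetaLaplaceReal, ← integral_complex_ofReal]
  congr 1
  ext t
  push_cast
  rfl

/-- Taking absolute values inside the integral leaves the decay rate π/2 − |im y|; as |ζ|² is even
and nonnegative, the result is twice a real Laplace transform, and 1/(2π) ≤ 1/2 absorbs the 2. -/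
lemma norm_lambertStrip_le {y : ℂ} (hy : |y.im| < π / 2) :
    ‖lambertStrip y‖ ≤ Real.exp (-y.re / 2) * zetaLaplaceReal (π / 2 - |y.im|) := by
  have hc : 0 < π / 2 - |y.im| := by linarith
  have h := norm_integral_le_of_norm_le ((integrable_zetaSq_mul_exp hc).const_mul
    (Real.exp (-y.re / 2))) (.of_forall fun t ↦ (norm_critKernel_mul_exp_le y t).trans
    (show _ ≤ Real.exp (-y.re / 2) * (zetaSq t * Real.exp (-(π / 2 - |y.im|) * |t|)) from by
      have h0 := zetaSq_nonneg t
      have : y.im * t ≤ |y.im| * |t| := (le_abs_self _).trans_eq (abs_mul _ _)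
      gcongr
      linarith))
  rw [integral_const_mul, integral_zetaSq_mul_exp_neg_abs] at h
  rw [lambertStrip_eq_integral hy, norm_mul]
  have h1 : ‖(1 / (2 * π) : ℂ)‖ ≤ 1 / 2 := by
    rw [norm_div, norm_one, norm_mul, norm_real, Real.norm_of_nonneg Real.pi_pos.le]
    simp
    have := Real.pi_gt_three
    rw [inv_le_one₀ (by linarith)]
    linarith
  have h2 := zetaLaplaceReal_nonneg (π / 2 - |y.im|)
  calc _ ≤ 1 / 2 * (Real.exp (-y.re / 2) * (2 * zetaLaplaceReal (π / 2 - |y.im|))) := by gcongr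
    _ = _ := by ring

/-- Rotating y almost to iπ/2 produces the growth exp(πt/2), which cancels the decay of the kernel
for t > 0 and leaves the Laplace factor exp(−wt). -/
lemma critKernel_mul_exp_eq (w : ℂ) (t : ℝ) :
    cexp (-(I * (π / 2 - w)) * (1 / 2 + t * I)) * critKernel t =
      cexp (I * w / 2) * (zetaSq t * cexp (-w * t)) / (1 + I * cexp (-(π * t))) := by
  have h0 := two_mul_cos_ne_zero t
  rw [critKernel]
  rw [two_mul_cos_eq] at h0 ⊢
  have h1 : (1 + I * cexp (-(π * t))) ≠ 0 := right_ne_zero_of_mul h0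
  have h2 : cexp (-(I * (π / 2 - w)) * (1 / 2 + t * I)) =
      cexp (I * w / 2) * cexp (-w * t) * (cexp (-(π / 4) * I) * cexp (π * t / 2)) := by
    rw [← exp_add, ← exp_add, ← exp_add]
    congr 1
    linear_combination (-(t : ℂ) * (π / 2 - w)) * I_mul_I
  rw [h2, mul_div_assoc', div_eq_div_iff h0 h1]
  ring

/-- For t > 0 the two integrands differ by a relative error exp(−πt); for t ≤ 0 the first decays
like exp(−(π − re w)|t|). Since re w ≤ 1, both are dominated by |ζ|² exp(−|t|). -/
theorem exists_norm_lambertStrip_sub_zetaLaplace_le :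
    ∃ C, 0 ≤ C ∧ ∀ w : ℂ, 0 < w.re → w.re ≤ 1 →
      ‖2 * π * lambertStrip (I * (π / 2 - w)) - cexp (I * w / 2) * zetaLaplace w‖ ≤
        C * Real.exp (-w.im / 2) := by
  refine ⟨∫ t : ℝ, zetaSq t * Real.exp (-1 * |t|),
    integral_nonneg fun t ↦ mul_nonneg (zetaSq_nonneg t) (Real.exp_pos _).le, fun w h0 h1 ↦ ?_⟩
  set y := I * (π / 2 - w) with hy
  have hyre : y.re = w.im := by simp [hy]
  have hyim : y.im = π / 2 - w.re := by simp [hy]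
  have hpi := Real.pi_gt_three
  have hys : |y.im| < π / 2 := by rw [hyim, abs_lt]; constructor <;> linarith
  have hK := continuous_critKernel
  have hpi0 : (2 * π : ℂ) ≠ 0 := by exact_mod_cast Real.two_pi_pos.ne'
  have hint : Integrable fun t : ℝ ↦ cexp (-y * (1 / 2 + t * I)) * critKernel t := by
    refine ((integrable_zetaSq_mul_exp (show 0 < π / 2 - |y.im| by linarith)).const_mul
      (Real.exp (-y.re / 2))).mono' (Continuous.aestronglyMeasurable (by fun_prop))
      (.of_forall fun t ↦ (norm_critKernel_mul_exp_le y t).trans ?_)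
    have h0 := zetaSq_nonneg t
    have : y.im * t ≤ |y.im| * |t| := (le_abs_self _).trans_eq (abs_mul _ _)
    gcongr
    linarith
  have hint2 := ((integrable_indicator_iff (measurableSet_Ioi (a := (0 : ℝ)))).2
    (integrableOn_zetaSq_mul_cexp h0)).const_mul (cexp (I * w / 2))
  rw [lambertStrip_eq_integral hys, ← mul_assoc, mul_one_div_cancel hpi0, one_mul, zetaLaplace,
    ← integral_indicator measurableSet_Ioi, ← integral_const_mul, ← integral_sub hint hint2,
    mul_comm _ (Real.exp _), ← integral_const_mul]
  refine norm_integral_le_of_norm_le ((integrable_zetaSq_mul_exp one_pos).const_mul _)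
    (.of_forall fun t ↦ ?_)
  have hz := zetaSq_nonneg t
  by_cases ht : 0 < t
  · rw [indicator_of_mem (show t ∈ Ioi (0 : ℝ) from ht), hy, critKernel_mul_exp_eq]
    have h3 := (norm_one_add_I_mul_exp (-(π * t))).1
    push_cast at h3
    have h4 : 1 + I * cexp (-(π * t)) ≠ 0 := by
      rw [← norm_pos_iff]; linarith
    have e : cexp (I * w / 2) * (zetaSq t * cexp (-w * t)) / (1 + I * cexp (-(π * t))) -
        cexp (I * w / 2) * (zetaSq t * cexp (-w * t)) =
        cexp (I * w / 2) * (zetaSq t * cexp (-w * t)) * (-(I * cexp (-(π * t)))) /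
          (1 + I * cexp (-(π * t))) := by
      rw [eq_div_iff h4, sub_mul, div_mul_cancel₀ _ h4]
      ring
    rw [e, norm_div]
    refine (div_le_self (norm_nonneg _) h3).trans ?_
    rw [norm_mul, norm_mul, norm_mul, norm_neg, norm_mul, norm_I, one_mul, norm_exp, norm_exp,
      norm_exp, norm_real, Real.norm_of_nonneg hz, abs_of_pos ht, mul_assoc, mul_assoc,
      ← Real.exp_add]
    have e1 : (I * w / 2).re = -w.im / 2 := by simp
    have e2 : (-w * (t : ℂ)).re + (-((π : ℂ) * t)).re = -w.re * t - π * t := by simp; ring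
    rw [e1, e2]
    gcongr
    nlinarith
  · rw [indicator_of_notMem (show t ∉ Ioi (0 : ℝ) from ht), mul_zero, sub_zero]
    push Not at ht
    refine (norm_critKernel_mul_exp_le y t).trans ?_
    rw [hyre, hyim, abs_of_nonpos ht]
    gcongr
    nlinarith

/-- A crude first bound. For real w = θ the Lambert series is evaluated at real part 2π sin θ ≥ θ,
where the trivial estimate with exponent 5/4 suffices; everything else is bounded. -/
lemma exists_zetaLaplaceReal_le :
    ∃ C, 0 ≤ C ∧ ∀ θ : ℝ, 0 < θ → θ ≤ 2 → zetaLaplaceReal θ ≤ C * θ ^ (-(5 / 4) : ℝ) := by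
  obtain ⟨C₁, hC₁, h₁⟩ := exists_norm_lambertStrip_sub_zetaLaplace_le
  obtain ⟨C₂, h₂⟩ := exists_norm_lambert_le (a := 5 / 4) (by norm_num)
  set C₃ := |Real.eulerMascheroniConstant| + |Real.log (2 * π)| + π / 2 with hC₃
  have hpi := Real.pi_gt_three
  have hC₂ : 0 ≤ C₂ := by
    have := (norm_nonneg _).trans (h₂ 1 (by simp))
    simpa using this
  have key : ∀ θ : ℝ, 0 < θ → θ ≤ 1 →
      zetaLaplaceReal θ ≤ (C₁ + 2 * π * (C₂ + C₃)) * θ ^ (-(5 / 4) : ℝ) := by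
    intro θ h0 h1
    have hone : 1 ≤ θ ^ (-(5 / 4) : ℝ) := Real.one_le_rpow_of_pos_of_le_one_of_nonpos h0 h1 (by norm_num)
    have h := h₁ θ (by simpa using h0) (by simpa using h1)
    set y : ℂ := I * (π / 2 - θ) with hy
    have hyre : y.re = 0 := by simp [hy]
    have hyim : y.im = π / 2 - θ := by simp [hy]
    have hys : |y.im| < π / 2 := by rw [hyim, abs_lt]; constructor <;> linarith
    have hre : (2 * π * cexp y).re = 2 * π * Real.sin θ := by
      have h : (2 * π * cexp y).re = 2 * π * (Real.exp y.re * Real.cos y.im) := by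
        rw [← exp_re, ← re_ofReal_mul]; push_cast; rfl
      rw [h, hyre, hyim, Real.cos_pi_div_two_sub]; simp
    have hsin : θ ≤ 2 * π * Real.sin θ := by
      have := Real.mul_le_sin h0.le (by linarith)
      calc θ ≤ 2 * π * (2 / π * θ) := by field_simp; linarith
        _ ≤ _ := by gcongr
    have e1 : ‖cexp (I * θ / 2)‖ = 1 := by rw [norm_exp]; simp
    have hlam : ‖lambert (2 * π * cexp y)‖ ≤ C₂ * θ ^ (-(5 / 4) : ℝ) := by
      refine (h₂ _ (re_two_pi_exp_pos hys)).trans ?_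
      rw [hre]
      gcongr ?_ * ?_
      exact Real.rpow_le_rpow_of_nonpos h0 hsin (by norm_num)
    have hsing : ‖((Real.eulerMascheroniConstant : ℂ) - (Real.log (2 * π) + y)) /
        (2 * π * cexp y)‖ ≤ C₃ := by
      have e3 : ‖(2 * π * cexp y : ℂ)‖ = 2 * π := by
        rw [norm_mul, norm_exp, hyre]; simp [abs_of_pos Real.pi_pos]
      rw [norm_div, e3]
      have : ‖y‖ ≤ π / 2 := by
        rw [hy, norm_mul, norm_I, one_mul, show (π / 2 - θ : ℂ) = ((π / 2 - θ : ℝ) : ℂ) by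
          push_cast; rfl, norm_real, Real.norm_of_nonneg (by linarith)]
        linarith
      refine (div_le_self (norm_nonneg _) (by linarith)).trans ?_
      refine (norm_sub_le _ _).trans ?_
      have h5 := norm_add_le (Real.log (2 * π) : ℂ) y
      rw [norm_real, Real.norm_eq_abs] at h5 ⊢
      linarith
    have hL : ‖lambertStrip y‖ ≤ C₂ * θ ^ (-(5 / 4) : ℝ) + C₃ :=
      (norm_sub_le _ _).trans (add_le_add hlam hsing)
    have h6 : zetaLaplaceReal θ = ‖cexp (I * θ / 2) * zetaLaplace θ‖ := by
      rw [norm_mul, e1, one_mul, zetaLaplace_ofReal, norm_real,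
        Real.norm_of_nonneg (zetaLaplaceReal_nonneg θ)]
    have h7 : ‖(2 * π * lambertStrip y : ℂ)‖ = 2 * π * ‖lambertStrip y‖ := by
      rw [norm_mul]; simp [abs_of_pos Real.pi_pos]
    have h8 := norm_sub_norm_le (cexp (I * θ / 2) * zetaLaplace θ) (2 * π * lambertStrip y)
    rw [norm_sub_rev] at h8
    simp only [ofReal_im, neg_zero, zero_div, Real.exp_zero, mul_one] at h
    have hC₃0 : 0 ≤ C₃ := by positivity
    rw [h6]
    calc _ ≤ C₁ + 2 * π * ‖lambertStrip y‖ := by linarith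
      _ ≤ C₁ * θ ^ (-(5 / 4) : ℝ) + 2 * π * (C₂ * θ ^ (-(5 / 4) : ℝ) + C₃ * θ ^ (-(5 / 4) : ℝ)) := by
          gcongr ?_ + _ * ?_
          · exact le_mul_of_one_le_right hC₁ hone
          · exact hL.trans (add_le_add le_rfl (le_mul_of_one_le_right hC₃0 hone))
      _ = _ := by ring
  -- Monotonicity extends the range from θ ≤ 1 to θ ≤ 2, enough to cover every value π/2 − |arg u|
  -- used below.
  refine ⟨(C₁ + 2 * π * (C₂ + C₃)) * 2 ^ (5 / 4 : ℝ), by positivity, fun θ h0 h2 ↦ ?_⟩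
  refine (zetaLaplaceReal_anti (half_pos h0) (half_le_self h0.le)).trans
    ((key _ (half_pos h0) (by linarith)).trans_eq ?_)
  rw [Real.div_rpow h0.le zero_le_two, Real.rpow_neg zero_le_two, div_inv_eq_mul]
  ring

/-! ### Expansion of the Laplace transform in the right half plane. -/

/-- A bootstrap: the crude Laplace bound is fed back through the integral formula at y = log(u/2π).
The distance of im y = arg u to the edge is at least its sine, re u/|u|, and exp(−re y/2)
contributes |u|^(−1/2), whence the exponent −1/2 + 5/4 = 3/4. -/
theorem exists_norm_lambert_sub_le :
    ∃ C, 0 ≤ C ∧ ∀ u : ℂ, 0 < u.re →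
      ‖lambert u - (Real.eulerMascheroniConstant - log u) / u‖ ≤
        C * ‖u‖ ^ (3 / 4 : ℝ) * u.re ^ (-(5 / 4) : ℝ) := by
  obtain ⟨C, hC, h⟩ := exists_zetaLaplaceReal_le
  refine ⟨(2 * π) ^ (1 / 2 : ℝ) * C, by positivity, fun u hu ↦ ?_⟩
  have hu0 : u ≠ 0 := by rintro rfl; simp at hu
  have hn : 0 < ‖u‖ := norm_pos_iff.2 hu0
  set y := log u - Real.log (2 * π) with hy
  have hyim : y.im = u.arg := by rw [hy, sub_im, log_im, ofReal_im, sub_zero]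
  have hyre : y.re = Real.log ‖u‖ - Real.log (2 * π) := by
    rw [hy, sub_re, log_re, ofReal_re]
  have hpi : (2 * π : ℂ) ≠ 0 := by exact_mod_cast Real.two_pi_pos.ne'
  have hexp : 2 * π * cexp y = u := by
    rw [hy, exp_sub, exp_log hu0, ← ofReal_exp, Real.exp_log Real.two_pi_pos]
    push_cast
    field_simp
  have harg : |u.arg| < π / 2 := abs_arg_lt_pi_div_two_iff.2 (Or.inl hu)
  have hys : |y.im| < π / 2 := by rw [hyim]; exact harg
  have e : lambertStrip y = lambert u - (Real.eulerMascheroniConstant - log u) / u := by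
    rw [lambertStrip, hexp, hy]
    ring
  rw [← e]
  refine (norm_lambertStrip_le hys).trans ?_
  have hc0 : 0 < π / 2 - |y.im| := by linarith
  have hcos : u.re / ‖u‖ ≤ π / 2 - |y.im| := by
    have h1 : Real.sin (π / 2 - |y.im|) = u.re / ‖u‖ := by
      rw [Real.sin_pi_div_two_sub, Real.cos_abs, hyim, cos_arg hu0]
    rw [← h1]
    exact Real.sin_le hc0.le
  have hpi4 := Real.pi_le_four
  have h2 : zetaLaplaceReal (π / 2 - |y.im|) ≤ C * (u.re / ‖u‖) ^ (-(5 / 4) : ℝ) := by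
    refine (h _ hc0 (by have := abs_nonneg y.im; linarith)).trans ?_
    gcongr ?_ * ?_
    exact Real.rpow_le_rpow_of_nonpos (by positivity) hcos (by norm_num)
  have h3 : Real.exp (-y.re / 2) = (2 * π) ^ (1 / 2 : ℝ) * ‖u‖ ^ (-(1 / 2) : ℝ) := by
    rw [Real.rpow_def_of_pos Real.two_pi_pos, Real.rpow_def_of_pos hn, ← Real.exp_add, hyre]
    ring_nf
  rw [h3]
  calc _ ≤ (2 * π) ^ (1 / 2 : ℝ) * ‖u‖ ^ (-(1 / 2) : ℝ) *
        (C * (u.re / ‖u‖) ^ (-(5 / 4) : ℝ)) := by gcongr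
    _ = _ := by
      rw [Real.div_rpow hu.le hn.le, Real.rpow_neg hn.le (5 / 4), div_inv_eq_mul,
        show (3 / 4 : ℝ) = -(1 / 2) + 5 / 4 by norm_num, Real.rpow_add hn]
      ring

lemma abs_log_le_rpow {x : ℝ} (hx : 0 < x) (hx1 : x ≤ 1) : |Real.log x| ≤ 2 * x ^ (-(1 / 2) : ℝ) := by
  have h := Real.log_le_rpow_div (x := x⁻¹) (ε := 1 / 2) (by positivity) (by norm_num)
  rw [Real.log_inv, Real.inv_rpow hx.le, ← Real.rpow_neg hx.le] at h
  rw [abs_of_nonpos (Real.log_nonpos hx.le hx1)]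
  linarith

lemma norm_log_two_pi_mul_le {w : ℂ} (hw : w ≠ 0) :
    ‖log (2 * π * w)‖ ≤ |Real.log (2 * π)| + |Real.log ‖w‖| + π := by
  have hn : 0 < ‖w‖ := norm_pos_iff.2 hw
  refine (norm_le_abs_re_add_abs_im _).trans ?_
  rw [log_re, log_im]
  have h1 : ‖(2 * π * w : ℂ)‖ = 2 * π * ‖w‖ := by simp [abs_of_pos Real.pi_pos]
  rw [h1, Real.log_mul Real.two_pi_pos.ne' hn.ne']
  exact add_le_add (abs_add_le _ _) (abs_arg_le_pi _)

/-- Comparison of the singular part at `2πi (exp (-iw) - 1)` with the one at `2πw`. -/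
lemma exists_norm_singular_sub_le :
    ∃ C, 0 ≤ C ∧ ∀ w : ℂ, 0 < w.re → ‖w‖ ≤ 1 / 4 →
      ‖2 * π * cexp (-(I * w / 2)) * ((Real.eulerMascheroniConstant -
          log (2 * π * I * (cexp (-(I * w)) - 1))) / (2 * π * I * (cexp (-(I * w)) - 1))) -
        (Real.eulerMascheroniConstant - log (2 * π * w)) / w‖ ≤ C * ‖w‖ ^ (-(1 / 2) : ℝ) := by
  set γ := Real.eulerMascheroniConstant
  refine ⟨3 * (|γ| + (|Real.log (2 * π)| + 2 + π)) + 3, by positivity, fun w hre hw ↦ ?_⟩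
  have hw0 : w ≠ 0 := by rintro rfl; simp at hre
  have hn : 0 < ‖w‖ := norm_pos_iff.2 hw0
  have hpi : (2 * π : ℂ) ≠ 0 := by exact_mod_cast Real.two_pi_pos.ne'
  -- The ratio of the two points 2πi(exp(−iw) − 1) and 2πw, equal to 1 + O(w).
  set ρ := I * (cexp (-(I * w)) - 1) / w with hρ
  have hIw : ‖-(I * w)‖ = ‖w‖ := by simp
  have hρ1 : ‖ρ - 1‖ ≤ ‖w‖ := by
    have h := norm_exp_sub_one_sub_id_le (x := -(I * w)) (by rw [hIw]; linarith)
    have e : ρ - 1 = I * (cexp (-(I * w)) - 1 - -(I * w)) / w := by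
      rw [hρ]
      field_simp
      linear_combination (-w) * I_sq
    rw [e, norm_div, norm_mul, norm_I, one_mul, div_le_iff₀ hn]
    rw [hIw] at h
    linarith
  have hρre : 0 < ρ.re := by
    have h := (abs_re_le_norm (ρ - 1)).trans hρ1
    rw [sub_re, one_re, abs_le] at h
    linarith [h.1]
  have hρn : 3 / 4 ≤ ‖ρ‖ := by
    have h := norm_sub_norm_le 1 ρ
    rw [norm_sub_rev, norm_one] at h
    linarith
  have hρ0 : ρ ≠ 0 := by rintro h; rw [h] at hρre; simp at hρre
  have hu : 2 * π * I * (cexp (-(I * w)) - 1) = 2 * π * w * ρ := by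
    rw [hρ]; field_simp
  -- The principal logarithm splits because both factors have positive real part.
  have hlog : log (2 * π * w * ρ) = log (2 * π * w) + log ρ := by
    have h1 : 0 < (2 * π * w : ℂ).re := by
      have : (2 * π * w : ℂ).re = 2 * π * w.re := by
        rw [← re_ofReal_mul]; push_cast; rfl
      rw [this]; positivity
    have h2 := abs_lt.1 (abs_arg_lt_pi_div_two_iff.2 (Or.inl h1))
    have h3 := abs_lt.1 (abs_arg_lt_pi_div_two_iff.2 (Or.inl hρre))
    refine log_mul (mul_ne_zero hpi hw0) hρ0 ⟨by linarith [h2.1, h3.1], by linarith [h2.2, h3.2]⟩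
  have hlogρ : ‖log ρ‖ ≤ 3 / 2 * ‖w‖ := by
    have h := norm_log_one_add_half_le_self (z := ρ - 1) (by linarith)
    rw [add_sub_cancel] at h
    linarith
  set e := cexp (-(I * w / 2)) with he
  have he1 : ‖e - 1‖ ≤ ‖w‖ := by
    have h2 : ‖-(I * w / 2)‖ = ‖w‖ / 2 := by simp
    have h := norm_exp_sub_one_le (x := -(I * w / 2)) (by rw [h2]; linarith)
    rw [h2] at h
    linarith
  have hen : ‖e‖ ≤ 5 / 4 := by
    have h := norm_sub_norm_le e 1
    rw [norm_one] at h
    linarith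
  have heρ : ‖e / ρ - 1‖ ≤ 3 * ‖w‖ := by
    have h1 : e / ρ - 1 = ((e - 1) - (ρ - 1)) / ρ := by field_simp; ring
    rw [h1, norm_div, div_le_iff₀ (by linarith)]
    have h2 := norm_sub_le (e - 1) (ρ - 1)
    nlinarith
  have hlr : ‖e * log ρ / ρ‖ ≤ 3 * ‖w‖ := by
    rw [norm_div, norm_mul, div_le_iff₀ (by linarith)]
    have h1 : ‖e‖ * ‖log ρ‖ ≤ 5 / 4 * (3 / 2 * ‖w‖) := by gcongr
    nlinarith
  have hℓ := norm_log_two_pi_mul_le hw0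
  have hlw := abs_log_le_rpow hn (by linarith)
  have hone : 1 ≤ ‖w‖ ^ (-(1 / 2) : ℝ) :=
    Real.one_le_rpow_of_pos_of_le_one_of_nonpos hn (by linarith) (by norm_num)
  rw [hu, hlog]
  set ℓ := log (2 * π * w)
  have hid : 2 * π * e * ((γ - (ℓ + log ρ)) / (2 * π * w * ρ)) - (γ - ℓ) / w =
      ((γ - ℓ) * (e / ρ - 1) - e * log ρ / ρ) / w := by
    field_simp
    ring
  rw [hid, norm_div, div_le_iff₀ hn]
  have h1 : ‖(γ : ℂ) - ℓ‖ ≤ |γ| + ‖ℓ‖ := by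
    refine (norm_sub_le _ _).trans_eq ?_
    rw [norm_real, Real.norm_eq_abs]
  set p := ‖w‖ ^ (-(1 / 2) : ℝ)
  have h2 : |γ| + ‖ℓ‖ ≤ (|γ| + (|Real.log (2 * π)| + 2 + π)) * p := by
    have a1 := le_mul_of_one_le_right (abs_nonneg γ) hone
    have a2 := le_mul_of_one_le_right (abs_nonneg (Real.log (2 * π))) hone
    have a3 := le_mul_of_one_le_right Real.pi_pos.le hone
    linarith
  calc _ ≤ ‖(γ : ℂ) - ℓ‖ * ‖e / ρ - 1‖ + ‖e * log ρ / ρ‖ := by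
        refine (norm_sub_le _ _).trans_eq ?_
        rw [norm_mul]
    _ ≤ ((|γ| + (|Real.log (2 * π)| + 2 + π)) * p) * (3 * ‖w‖) + 3 * ‖w‖ * p := by
        gcongr
        · exact h1.trans h2
        · exact hlr.trans (le_mul_of_one_le_right (by positivity) hone)
    _ = _ := by ring

lemma rpow_mul_rpow_ge {θ r : ℝ} (hθ : 0 < θ) (h : θ ≤ r) :
    r ^ (-(1 / 2) : ℝ) ≤ r ^ (3 / 4 : ℝ) * θ ^ (-(5 / 4) : ℝ) := by
  have hr := hθ.trans_le h
  calc r ^ (-(1 / 2) : ℝ) = r ^ (3 / 4 : ℝ) * r ^ (-(5 / 4) : ℝ) := by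
        rw [← Real.rpow_add hr]; norm_num
    _ ≤ _ := by
        gcongr ?_ * ?_
        exact Real.rpow_le_rpow_of_nonpos hθ h (by norm_num)

/-- With z = 2π exp y = u + 2πi, periodicity replaces the Lambert series at z by its value at u,
which is near 2πw and so close to the singularity at 0. The singular part at z itself is bounded,
and the one at u may be replaced by the one at 2πw. -/
lemma exists_norm_zetaLaplace_sub_le_of_small :
    ∃ C, 0 ≤ C ∧ ∀ w : ℂ, 0 < w.re → ‖w‖ ≤ 1 / 4 →
      ‖zetaLaplace w - (Real.eulerMascheroniConstant - log (2 * π * w)) / w‖ ≤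
        C * (‖w‖ ^ (3 / 4 : ℝ) * w.re ^ (-(5 / 4) : ℝ)) := by
  set γ := Real.eulerMascheroniConstant
  obtain ⟨C₁, hC₁, h₁⟩ := exists_norm_lambertStrip_sub_zetaLaplace_le
  obtain ⟨C₂, hC₂, h₂⟩ := exists_norm_lambert_sub_le
  obtain ⟨C₃, hC₃, h₃⟩ := exists_norm_singular_sub_le
  set C₄ := |γ| + |Real.log (2 * π)| + (π / 2 + 1) with hC₄
  refine ⟨2 * (2 * C₁ + 2 * π * (C₂ * (4 * π) ^ (3 / 4 : ℝ)) + 2 * C₄) + C₃, by positivity,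
    fun w hre hw ↦ ?_⟩
  have hw0 : w ≠ 0 := by rintro rfl; simp at hre
  have hn : 0 < ‖w‖ := norm_pos_iff.2 hw0
  have hrew : w.re ≤ ‖w‖ := re_le_norm w
  have hpi3 := Real.pi_gt_three
  have him : |w.im| ≤ 1 / 4 := (abs_im_le_norm w).trans hw
  have him' := abs_le.1 him
  set y : ℂ := I * (π / 2 - w) with hy
  have hyre : y.re = w.im := by simp [hy]
  have hyim : y.im = π / 2 - w.re := by simp [hy]
  have hys : |y.im| < π / 2 := by rw [hyim, abs_lt]; constructor <;> linarith
  set u : ℂ := 2 * π * I * (cexp (-(I * w)) - 1) with hu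
  set z : ℂ := 2 * π * cexp y with hz
  have hzu : z = u + 2 * π * I := by
    have : cexp y = I * cexp (-(I * w)) := by
      rw [hy, mul_sub, sub_eq_add_neg, exp_add, mul_comm I, exp_pi_div_two_mul_I]
    rw [hz, this, hu]
    ring
  have hlam : lambert z = lambert u := by rw [hzu, lambert_add_two_pi_I]
  have hure : w.re ≤ u.re := by
    have h1 : u.re = z.re := by rw [hzu]; simp
    have h2 : z.re = 2 * π * (Real.exp w.im * Real.sin w.re) := by
      have h : z.re = 2 * π * (Real.exp y.re * Real.cos y.im) := by
        rw [hz, ← exp_re, ← re_ofReal_mul]; push_cast; rfl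
      rw [h, hyre, hyim, Real.cos_pi_div_two_sub]
    have h3 := Real.mul_le_sin hre.le (by linarith)
    have h4 : 1 / 2 ≤ Real.exp w.im := by
      linarith [Real.add_one_le_exp w.im]
    rw [h1, h2]
    calc w.re ≤ 2 * π * (1 / 2 * (2 / π * w.re)) := by field_simp; linarith
      _ ≤ _ := by gcongr
  have hure0 : 0 < u.re := hre.trans_le hure
  have hun : ‖u‖ ≤ 4 * π * ‖w‖ := by
    have hIw : ‖-(I * w)‖ = ‖w‖ := by simp
    have h := norm_exp_sub_one_le (x := -(I * w)) (by rw [hIw]; linarith)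
    rw [hIw] at h
    rw [hu, norm_mul]
    have : ‖(2 * π * I : ℂ)‖ = 2 * π := by simp [abs_of_pos Real.pi_pos]
    rw [this]
    nlinarith
  set P := ‖w‖ ^ (3 / 4 : ℝ) * w.re ^ (-(5 / 4) : ℝ) with hP
  have hP1 : ‖w‖ ^ (-(1 / 2) : ℝ) ≤ P := rpow_mul_rpow_ge hre hrew
  have hone : 1 ≤ P := le_trans
    (Real.one_le_rpow_of_pos_of_le_one_of_nonpos hn (by linarith) (by norm_num)) hP1
  have hA := h₁ w hre (by linarith)
  rw [← hy] at hA
  have hexp2 : ∀ v : ℝ, v ≤ 1 / 4 → Real.exp v ≤ 2 := fun v hv ↦ by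
    have := Real.exp_bound_div_one_sub_of_interval (x := 1 / 4) (by norm_num) (by norm_num)
    have h := Real.exp_le_exp.2 hv
    norm_num at this
    linarith
  have hA' : ‖2 * π * lambertStrip y - cexp (I * w / 2) * zetaLaplace w‖ ≤ 2 * C₁ * P := by
    refine hA.trans ?_
    have := hexp2 (-w.im / 2) (by linarith)
    nlinarith
  have hB : ‖lambert u - (γ - log u) / u‖ ≤ C₂ * (4 * π) ^ (3 / 4 : ℝ) * P := by
    refine (h₂ u hure0).trans ?_
    have h5 : ‖u‖ ^ (3 / 4 : ℝ) ≤ (4 * π) ^ (3 / 4 : ℝ) * ‖w‖ ^ (3 / 4 : ℝ) := by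
      rw [← Real.mul_rpow (by positivity) hn.le]
      gcongr
    have h6 : u.re ^ (-(5 / 4) : ℝ) ≤ w.re ^ (-(5 / 4) : ℝ) :=
      Real.rpow_le_rpow_of_nonpos hre hure (by norm_num)
    calc _ ≤ C₂ * ((4 * π) ^ (3 / 4 : ℝ) * ‖w‖ ^ (3 / 4 : ℝ)) * w.re ^ (-(5 / 4) : ℝ) := by gcongr
      _ = _ := by rw [hP]; ring
  have hD : ‖2 * π * ((γ - (Real.log (2 * π) + y)) / z)‖ ≤ 2 * C₄ := by
    have hzn : ‖z‖ = 2 * π * Real.exp w.im := by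
      rw [hz, norm_mul, norm_exp, hyre]; simp [abs_of_pos Real.pi_pos]
    have hyn : ‖y‖ ≤ π / 2 + 1 := by
      rw [hy, norm_mul, norm_I, one_mul]
      refine (norm_sub_le _ _).trans ?_
      have : ‖(π / 2 : ℂ)‖ = π / 2 := by simp [abs_of_pos Real.pi_pos]
      rw [this]
      linarith
    have h5 : ‖(γ - (Real.log (2 * π) + y) : ℂ)‖ ≤ C₄ := by
      refine (norm_sub_le _ _).trans ?_
      have h5 := norm_add_le (Real.log (2 * π) : ℂ) y
      rw [norm_real, Real.norm_eq_abs] at h5 ⊢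
      linarith
    have h6 : ‖(2 * π : ℂ)‖ = 2 * π := by simp [abs_of_pos Real.pi_pos]
    have h4 : 1 / 2 ≤ Real.exp w.im := by
      linarith [Real.add_one_le_exp w.im]
    rw [norm_mul, norm_div, hzn, h6, mul_div_assoc', div_le_iff₀ (by positivity)]
    have hC₄0 : 0 ≤ C₄ := by positivity
    calc _ ≤ 2 * π * C₄ := by gcongr
      _ = 2 * C₄ * (2 * π * (1 / 2)) := by ring
      _ ≤ _ := by gcongr
  have hC₄0 : 0 ≤ C₄ := by positivity
  have hmain : ‖cexp (I * w / 2) * zetaLaplace w - 2 * π * ((γ - log u) / u)‖ ≤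
      (2 * C₁ + 2 * π * (C₂ * (4 * π) ^ (3 / 4 : ℝ)) + 2 * C₄) * P := by
    have e : cexp (I * w / 2) * zetaLaplace w - 2 * π * ((γ - log u) / u) =
        -(2 * π * lambertStrip y - cexp (I * w / 2) * zetaLaplace w) +
        2 * π * (lambert u - (γ - log u) / u) - 2 * π * ((γ - (Real.log (2 * π) + y)) / z) := by
      rw [lambertStrip, ← hz, hlam]
      ring
    have h6 : ‖(2 * π : ℂ)‖ = 2 * π := by simp [abs_of_pos Real.pi_pos]
    rw [e]
    refine (norm_sub_le _ _).trans ((add_le_add_left (norm_add_le _ _) _).trans ?_)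
    rw [norm_neg, norm_mul (2 * π : ℂ) (lambert u - _), h6]
    calc _ ≤ 2 * C₁ * P + 2 * π * (C₂ * (4 * π) ^ (3 / 4 : ℝ) * P) + 2 * C₄ * P := by
          gcongr
          exact hD.trans (le_mul_of_one_le_right (by positivity) hone)
      _ = _ := by ring
  have hfin := h₃ w hre hw
  rw [← hu] at hfin
  have ee : cexp (-(I * w / 2)) * cexp (I * w / 2) = 1 := by rw [← exp_add]; simp
  have e : zetaLaplace w - (γ - log (2 * π * w)) / w =
      cexp (-(I * w / 2)) * (cexp (I * w / 2) * zetaLaplace w - 2 * π * ((γ - log u) / u)) +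
      (2 * π * cexp (-(I * w / 2)) * ((γ - log u) / u) - (γ - log (2 * π * w)) / w) := by
    linear_combination (-zetaLaplace w) * ee
  have hen : ‖cexp (-(I * w / 2))‖ ≤ 2 := by
    rw [norm_exp]
    have : (-(I * w / 2)).re = w.im / 2 := by simp; ring
    rw [this]
    exact hexp2 _ (by linarith)
  rw [e]
  refine (norm_add_le _ _).trans ?_
  rw [norm_mul]
  calc _ ≤ 2 * ((2 * C₁ + 2 * π * (C₂ * (4 * π) ^ (3 / 4 : ℝ)) + 2 * C₄) * P) + C₃ * P := by
        gcongr
        exact hfin.trans (by gcongr)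
    _ = _ := by ring

/-- Perron's formula needs a whole vertical line. Away from 0 no cancellation is required: the
transform is at most its value at re w, and the main term is bounded. -/
theorem exists_norm_zetaLaplace_sub_le :
    ∃ C, 0 ≤ C ∧ ∀ w : ℂ, 0 < w.re → w.re ≤ 1 →
      ‖zetaLaplace w - (Real.eulerMascheroniConstant - log (2 * π * w)) / w‖ ≤
        C * (‖w‖ ^ (3 / 4 : ℝ) * w.re ^ (-(5 / 4) : ℝ)) := by
  set γ := Real.eulerMascheroniConstant
  obtain ⟨C₁, hC₁, h₁⟩ := exists_norm_zetaLaplace_sub_le_of_small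
  obtain ⟨C₂, hC₂, h₂⟩ := exists_zetaLaplaceReal_le
  set C₃ := 4 * (|γ| + |Real.log (2 * π)| + π) + 17 with hC₃
  refine ⟨C₁ + 4 * (C₂ + C₃), by positivity, fun w h0 h1 ↦ ?_⟩
  have hw0 : w ≠ 0 := by rintro rfl; simp at h0
  have hn : 0 < ‖w‖ := norm_pos_iff.2 hw0
  have hθ : 0 < w.re ^ (-(5 / 4) : ℝ) := Real.rpow_pos_of_pos h0 _
  rcases le_or_gt ‖w‖ (1 / 4) with hs | hs
  · refine (h₁ w h0 hs).trans ?_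
    gcongr
    have : 0 ≤ C₃ := by positivity
    linarith
  · have hone : 1 ≤ w.re ^ (-(5 / 4) : ℝ) :=
      Real.one_le_rpow_of_pos_of_le_one_of_nonpos h0 h1 (by norm_num)
    have hw34 : 1 / 4 ≤ ‖w‖ ^ (3 / 4 : ℝ) := by
      calc (1 / 4 : ℝ) = (1 / 4) ^ (1 : ℝ) := (Real.rpow_one _).symm
        _ ≤ (1 / 4) ^ (3 / 4 : ℝ) :=
          Real.rpow_le_rpow_of_exponent_ge (by norm_num) (by norm_num) (by norm_num)
        _ ≤ _ := by gcongr
    have hlog : |Real.log ‖w‖| ≤ ‖w‖ + 4 := by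
      have a1 := Real.log_le_sub_one_of_pos hn
      have a2 := Real.one_sub_inv_le_log_of_pos hn
      have a3 : ‖w‖⁻¹ ≤ 4 := by
        rw [inv_le_comm₀ hn (by norm_num)]; linarith
      rw [abs_le]
      constructor <;> linarith
    have hsing : ‖(γ - log (2 * π * w)) / w‖ ≤ C₃ := by
      rw [norm_div, div_le_iff₀ hn]
      have h2 : ‖(γ - log (2 * π * w) : ℂ)‖ ≤ |γ| + (|Real.log (2 * π)| + |Real.log ‖w‖| + π) := by
        refine (norm_sub_le _ _).trans ?_
        rw [norm_real, Real.norm_eq_abs]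
        gcongr
        exact norm_log_two_pi_mul_le hw0
      have h3 : 0 ≤ |γ| + |Real.log (2 * π)| + π := by positivity
      nlinarith
    have hL : ‖zetaLaplace w‖ ≤ C₂ * w.re ^ (-(5 / 4) : ℝ) :=
      (norm_zetaLaplace_le w).trans (h₂ _ h0 (by linarith))
    have hC₃0 : 0 ≤ C₃ := by positivity
    calc _ ≤ C₂ * w.re ^ (-(5 / 4) : ℝ) + C₃ * w.re ^ (-(5 / 4) : ℝ) :=
          (norm_sub_le _ _).trans
            (add_le_add hL (hsing.trans (le_mul_of_one_le_right hC₃0 hone)))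
      _ = (4 * (C₂ + C₃)) * (1 / 4 * w.re ^ (-(5 / 4) : ℝ)) := by ring
      _ ≤ (C₁ + 4 * (C₂ + C₃)) * (‖w‖ ^ (3 / 4 : ℝ) * w.re ^ (-(5 / 4) : ℝ)) := by
          gcongr
          linarith

/-! ### Explicit Laplace transforms and the deviation from the mean. -/

/-- Laplace transforms are holomorphic in the half plane of convergence. -/
lemma differentiableAt_laplace {f : ℝ → ℝ} (hf : Measurable f)
    (hi : ∀ θ : ℝ, 0 < θ → IntegrableOn (fun t ↦ f t * Real.exp (-θ * t)) (Ioi 0))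
    {w : ℂ} (hw : 0 < w.re) :
    DifferentiableAt ℂ (fun w : ℂ ↦ ∫ t in Ioi (0 : ℝ), (f t : ℂ) * cexp (-w * t)) w := by
  set r := w.re / 4 with hr
  have hr0 : 0 < r := by positivity
  have hbound : ∀ x ∈ Metric.ball w r, ∀ t : ℝ, 0 < t → ‖(f t : ℂ) * cexp (-x * t)‖ ≤
      |f t| * Real.exp (-(3 * r) * t) := by
    intro x hx t ht
    have hx' : ‖x - w‖ < r := by simpa [dist_eq_norm] using hx
    have h1 := (abs_lt.1 ((abs_re_le_norm (x - w)).trans_lt hx')).1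
    rw [norm_mul, norm_real, Real.norm_eq_abs, norm_exp]
    gcongr
    simp only [neg_mul, neg_re, mul_re, ofReal_re, ofReal_im, mul_zero, sub_zero]
    rw [sub_re] at h1
    nlinarith
  refine (hasDerivAt_integral_of_dominated_loc_of_deriv_le
    (F := fun (w : ℂ) (t : ℝ) ↦ (f t : ℂ) * cexp (-w * t))
    (F' := fun (w : ℂ) (t : ℝ) ↦ -t * ((f t : ℂ) * cexp (-w * t))) (x₀ := w)
    (bound := fun t ↦ r⁻¹ * |f t * Real.exp (-(2 * r) * t)|)
    (Metric.ball_mem_nhds w hr0) (.of_forall fun x ↦ Measurable.aestronglyMeasurable (by fun_prop))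
    ?_ (Measurable.aestronglyMeasurable (by fun_prop)) ?_
    ((hi (2 * r) (by positivity)).abs.const_mul _) ?_).2.differentiableAt
  · refine (hi (3 * r) (by positivity)).abs.mono' (Measurable.aestronglyMeasurable (by fun_prop)) ?_
    filter_upwards [ae_restrict_mem measurableSet_Ioi] with t ht
    rw [abs_mul, Real.abs_exp]
    exact hbound w (Metric.mem_ball_self hr0) t ht
  · filter_upwards [ae_restrict_mem measurableSet_Ioi] with t (ht : 0 < t) x hx
    rw [norm_mul, norm_neg, norm_real, Real.norm_of_nonneg ht.le, abs_mul, Real.abs_exp]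
    have h1 : t ≤ r⁻¹ * Real.exp (r * t) := by
      have := Real.add_one_le_exp (r * t)
      rw [inv_mul_eq_div, le_div_iff₀ hr0]
      linarith
    calc _ ≤ r⁻¹ * Real.exp (r * t) * (|f t| * Real.exp (-(3 * r) * t)) := by
          gcongr
          exact hbound x hx t ht
      _ = r⁻¹ * (|f t| * (Real.exp (r * t) * Real.exp (-(3 * r) * t))) := by ring
      _ = _ := by rw [← Real.exp_add]; ring_nf
  · refine .of_forall fun t x _ ↦ ?_
    have h1 : HasDerivAt (fun x : ℂ ↦ -x * (t : ℂ)) (-t) x := by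
      simpa using (hasDerivAt_neg x).mul_const (t : ℂ)
    refine (h1.cexp.const_mul (f t : ℂ)).congr_deriv ?_
    ring

/-- Holomorphic functions on `re w > 0` that agree on the positive reals are equal. -/
lemma eq_of_eq_ofReal_pos {f g : ℂ → ℂ} (hf : ∀ s : ℂ, 0 < s.re → DifferentiableAt ℂ f s)
    (hg : ∀ s : ℂ, 0 < s.re → DifferentiableAt ℂ g s) (h : ∀ x : ℝ, 0 < x → f x = g x)
    {s : ℂ} (hs : 0 < s.re) : f s = g s := by
  have hU : IsOpen {s : ℂ | 0 < s.re} := isOpen_lt continuous_const continuous_re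
  have hfU : AnalyticOnNhd ℂ f {s : ℂ | 0 < s.re} :=
    DifferentiableOn.analyticOnNhd (fun s hs ↦ (hf s hs).differentiableWithinAt) hU
  have hgU : AnalyticOnNhd ℂ g {s : ℂ | 0 < s.re} :=
    DifferentiableOn.analyticOnNhd (fun s hs ↦ (hg s hs).differentiableWithinAt) hU
  refine hfU.eqOn_of_preconnected_of_frequently_eq hgU
    (convex_halfSpace_re_gt 0).isPreconnected (z₀ := 1) (by simp) ?_ hs
  have ht : Tendsto (fun x : ℝ ↦ (x : ℂ)) (𝓝[≠] 1) (𝓝[≠] 1) := by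
    refine tendsto_nhdsWithin_iff.2 ⟨?_, ?_⟩
    · exact (continuous_ofReal.tendsto' 1 1 (by simp)).mono_left nhdsWithin_le_nhds
    · filter_upwards [self_mem_nhdsWithin] with x hx
      simpa using hx
  refine ht.frequently (Eventually.frequently ?_)
  filter_upwards [nhdsWithin_le_nhds (Ioi_mem_nhds one_pos)] with x hx using h x hx

/-- The Laplace transform of log is the s-derivative at s = 1 of the Mellin transform of exp(−θt).
-/
lemma mellinConvergent_log_exp_neg {θ : ℝ} (hθ : 0 < θ) :
    MellinConvergent (fun t : ℝ ↦ Real.log t • cexp (-θ * t)) 1 ∧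
    HasDerivAt (mellin fun t : ℝ ↦ cexp (-θ * t))
      (mellin (fun t : ℝ ↦ Real.log t • cexp (-θ * t)) 1) 1 := by
  have hnorm : ∀ t : ℝ, ‖cexp (-θ * t)‖ = Real.exp (-θ * t) := fun t ↦ by
    rw [norm_exp]; simp
  refine mellin_hasDerivAt_of_isBigO_rpow (f := fun t : ℝ ↦ cexp (-θ * t)) (a := 2) (b := 0)
    (s := 1) ((Continuous.locallyIntegrable (by fun_prop)).locallyIntegrableOn _) ?_ (by simp) ?_
    (by simp)
  · refine Asymptotics.IsBigO.of_norm_left ?_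
    simp only [hnorm]
    exact (isLittleO_exp_neg_mul_rpow_atTop hθ _).isBigO
  · refine Asymptotics.IsBigO.of_bound 1 ?_
    filter_upwards [self_mem_nhdsWithin] with t (ht : 0 < t)
    rw [hnorm]
    simp only [neg_zero, Real.rpow_zero, norm_one, mul_one]
    exact Real.exp_le_one_iff.2 (by nlinarith)

lemma integrableOn_log_mul_exp {θ : ℝ} (hθ : 0 < θ) :
    IntegrableOn (fun t ↦ Real.log t * Real.exp (-θ * t)) (Ioi 0) := by
  refine (mellinConvergent_log_exp_neg hθ).1.norm.mono' (Measurable.aestronglyMeasurable ?_) ?_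
  · exact Real.measurable_log.mul (by fun_prop)
  · refine .of_forall fun t ↦ le_of_eq ?_
    simp [norm_exp]

/-- For w = θ > 0 this is the derivative of θ^(−s) Γ(s) at s = 1, with Γ′(1) = −γ; complex w follow
by uniqueness of continuation. -/
lemma integral_log_mul_cexp {w : ℂ} (hw : 0 < w.re) :
    ∫ t in Ioi (0 : ℝ), (Real.log t : ℂ) * cexp (-w * t) =
      (-Real.eulerMascheroniConstant - log w) / w := by
  refine eq_of_eq_ofReal_pos
    (f := fun w : ℂ ↦ ∫ t in Ioi (0 : ℝ), (Real.log t : ℂ) * cexp (-w * t))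
    (g := fun w ↦ (-Real.eulerMascheroniConstant - log w) / w)
    (fun w hw ↦ differentiableAt_laplace Real.measurable_log
      (fun θ hθ ↦ integrableOn_log_mul_exp hθ) hw) (fun w hw ↦ ?_) (fun θ hθ ↦ ?_) hw
  · have h0 : w ≠ 0 := by rintro rfl; simp at hw
    have h1 := differentiableAt_log (z := w) (Or.inl hw)
    fun_prop (disch := assumption)
  · have h := mellinConvergent_log_exp_neg hθ
    have e : ∀ t ∈ Ioi (0 : ℝ), (t : ℂ) ^ ((1 : ℂ) - 1) • (Real.log t • cexp (-θ * t)) =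
        (Real.log t : ℂ) * cexp (-θ * t) := fun t _ ↦ by simp
    have hθ0 : (θ : ℂ) ≠ 0 := ofReal_ne_zero.2 hθ.ne'
    rw [← setIntegral_congr_fun measurableSet_Ioi e]
    refine h.2.unique ?_
    have hinv : (1 / θ : ℂ) ≠ 0 := one_div_ne_zero hθ0
    have hd : HasDerivAt (fun s : ℂ ↦ (1 / θ : ℂ) ^ s * Gamma s)
        ((1 / θ : ℂ) ^ (1 : ℂ) * log (1 / θ) * Gamma 1 +
          (1 / θ : ℂ) ^ (1 : ℂ) * -(Real.eulerMascheroniConstant : ℂ)) 1 := by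
      have h1 := (hasDerivAt_id (1 : ℂ)).const_cpow (c := (1 / θ : ℂ)) (Or.inl hinv)
      simp only [id, mul_one] at h1
      exact h1.mul hasDerivAt_Gamma_one
    refine (hd.congr_deriv ?_).congr_of_eventuallyEq ?_
    · rw [Gamma_one, cpow_one, one_div,
        log_inv _ (by rw [arg_ofReal_of_nonneg hθ.le]; exact Real.pi_pos.ne)]
      field_simp
      ring
    · filter_upwards [(isOpen_lt continuous_const continuous_re).mem_nhds
        (show (1 : ℂ) ∈ {s : ℂ | 0 < s.re} by simp)] with s hs
      rw [← integral_cpow_mul_exp_neg_mul_Ioi hs hθ, mellin]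
      simp [neg_mul]

lemma integral_ofReal_mul_cexp {w : ℂ} (hw : 0 < w.re) :
    ∫ t in Ioi (0 : ℝ), (t : ℂ) * cexp (-w * t) = 1 / w ^ 2 := by
  refine eq_of_eq_ofReal_pos (f := fun w : ℂ ↦ ∫ t in Ioi (0 : ℝ), (t : ℂ) * cexp (-w * t))
    (g := fun w ↦ 1 / w ^ 2) (fun w hw ↦ differentiableAt_laplace (f := id) measurable_id
      (fun θ hθ ↦ ?_) hw) (fun w hw ↦ ?_) (fun θ hθ ↦ ?_) hw
  · refine ((integrable_one_add_abs_pow_mul_exp hθ 1).integrableOn).mono'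
      (Continuous.aestronglyMeasurable (by fun_prop)) ?_
    filter_upwards [ae_restrict_mem measurableSet_Ioi] with t (ht : 0 < t)
    rw [id, abs_of_pos ht, pow_one, Real.norm_of_nonneg (by positivity)]
    gcongr
    linarith
  · have h0 : w ^ 2 ≠ 0 := pow_ne_zero _ (by rintro rfl; simp at hw)
    fun_prop (disch := assumption)
  · have h := integral_cpow_mul_exp_neg_mul_Ioi (a := 2) (by simp) hθ
    have hG : Gamma 2 = 1 := by simp
    have e2 : (1 / θ : ℂ) ^ (2 : ℂ) = 1 / θ ^ 2 := by
      rw [show (2 : ℂ) = ((2 : ℕ) : ℂ) by norm_num, cpow_natCast, div_pow, one_pow]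
    rw [hG, mul_one, e2] at h
    rw [← h]
    refine setIntegral_congr_fun measurableSet_Ioi fun v _ ↦ ?_
    rw [show (2 : ℂ) - 1 = 1 by norm_num, cpow_one, neg_mul]

/-- The constant term of the mean value of `|ζ(1/2 + it)|²`. -/
noncomputable def meanConst : ℝ := 2 * Real.eulerMascheroniConstant - Real.log (2 * π)

/-- The deviation of `|ζ(1/2 + it)|²` from its local mean value. -/
noncomputable def zetaDev (t : ℝ) : ℝ := zetaSq t - Real.log t - meanConst

lemma measurable_zetaDev : Measurable zetaDev :=
  (continuous_zetaSq.measurable.sub Real.measurable_log).sub_const _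

lemma integrableOn_and_integral_cexp {w : ℂ} (hw : 0 < w.re) :
    IntegrableOn (fun t : ℝ ↦ cexp (-w * t)) (Ioi 0) ∧
      ∫ t in Ioi (0 : ℝ), cexp (-w * t) = 1 / w := by
  have h : (-w).re < 0 := by simpa using hw
  refine ⟨integrableOn_exp_mul_complex_Ioi h 0, ?_⟩
  rw [integral_exp_mul_complex_Ioi h 0]
  simp

/-- `meanConst` is chosen so that −γ − log w + `meanConst` = γ − log 2πw: the subtracted functions
have exactly the main term as their transform. -/
lemma integrableOn_and_integral_zetaDev {w : ℂ} (hw : 0 < w.re) :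
    IntegrableOn (fun t : ℝ ↦ (zetaDev t : ℂ) * cexp (-w * t)) (Ioi 0) ∧
    ∫ t in Ioi (0 : ℝ), (zetaDev t : ℂ) * cexp (-w * t) =
      zetaLaplace w - (Real.eulerMascheroniConstant - log (2 * π * w)) / w := by
  have hw0 : w ≠ 0 := by rintro rfl; simp at hw
  have e1 := integral_log_mul_cexp hw
  have i1 : IntegrableOn (fun t : ℝ ↦ (Real.log t : ℂ) * cexp (-w * t)) (Ioi 0) := by
    refine (integrableOn_log_mul_exp hw).norm.mono' (Measurable.aestronglyMeasurable ?_)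
      (.of_forall fun t ↦ le_of_eq ?_)
    · exact (measurable_ofReal.comp Real.measurable_log).mul (by fun_prop)
    · simp [norm_exp]
  obtain ⟨i2, e2⟩ := integrableOn_and_integral_cexp hw
  have i0 := integrableOn_zetaSq_mul_cexp hw
  have i3 := i2.const_mul (meanConst : ℂ)
  have e : (fun t : ℝ ↦ (zetaDev t : ℂ) * cexp (-w * t)) = fun t : ℝ ↦
      (zetaSq t : ℂ) * cexp (-w * t) - (Real.log t : ℂ) * cexp (-w * t) -
        (meanConst : ℂ) * cexp (-w * t) := by
    ext t
    rw [zetaDev]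
    push_cast
    ring
  have hlog : log (2 * π * w) = Real.log (2 * π) + log w := by
    have := log_ofReal_mul Real.two_pi_pos hw0
    push_cast at this ⊢
    exact this
  rw [e]
  refine ⟨(i0.sub i1).sub i3, ?_⟩
  have i01 : IntegrableOn (fun t : ℝ ↦ (zetaSq t : ℂ) * cexp (-w * t) -
      (Real.log t : ℂ) * cexp (-w * t)) (Ioi 0) := i0.sub i1
  rw [integral_sub i01 i3, integral_sub i0 i1, e1, integral_const_mul, e2, hlog,
    meanConst, ← zetaLaplace]
  push_cast
  field_simp
  ring

/-! ### Perron's formula and the Riesz mean. -/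

lemma norm_add_mul_I_rpow {θ : ℝ} (hθ : 0 < θ) (r v : ℝ) :
    ‖(θ + v * I : ℂ)‖ ^ (-r) = θ ^ (-r) * (1 + ‖v * θ⁻¹‖ ^ 2) ^ (-r / 2) := by
  have h : ‖(θ + v * I : ℂ)‖ = θ * (1 + ‖v * θ⁻¹‖ ^ 2) ^ (1 / 2 : ℝ) := by
    rw [norm_add_mul_I, ← Real.sqrt_eq_rpow]
    nth_rewrite 2 [← Real.sqrt_sq hθ.le]
    rw [← Real.sqrt_mul (by positivity), Real.norm_eq_abs, sq_abs]
    congr 1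
    field_simp
  rw [h, Real.mul_rpow hθ.le (by positivity), ← Real.rpow_mul (by positivity)]
  ring_nf

lemma integrable_norm_add_mul_I_rpow {θ r : ℝ} (hθ : 0 < θ) (hr : 1 < r) :
    Integrable fun v : ℝ ↦ ‖(θ + v * I : ℂ)‖ ^ (-r) := by
  simp only [norm_add_mul_I_rpow hθ]
  refine Integrable.const_mul ?_ _
  exact (integrable_rpow_neg_one_add_norm_sq (E := ℝ) (μ := volume) (r := r)
    (by simpa using hr)).comp_mul_right' (inv_ne_zero hθ.ne')

lemma integral_norm_add_mul_I_rpow {θ : ℝ} (hθ : 0 < θ) (r : ℝ) :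
    ∫ v : ℝ, ‖(θ + v * I : ℂ)‖ ^ (-r) =
      θ ^ (1 - r) * ∫ v : ℝ, (1 + ‖v‖ ^ 2) ^ (-r / 2) := by
  simp only [norm_add_mul_I_rpow hθ]
  rw [integral_const_mul, Measure.integral_comp_mul_right (fun v : ℝ ↦ (1 + ‖v‖ ^ 2) ^ (-r / 2)),
    inv_inv, abs_of_pos hθ, smul_eq_mul, ← mul_assoc, ← Real.rpow_add_one hθ.ne']
  ring_nf

lemma add_mul_I_ne_zero {θ : ℝ} (hθ : 0 < θ) (v : ℝ) : (θ + v * I : ℂ) ≠ 0 := by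
  intro h
  have := congrArg re h
  simp at this
  exact hθ.ne' this

open scoped FourierTransform in
-- Fourier inversion for the continuous function max(x, 0) exp(−θx), whose transform (θ + 2πiξ)⁻² is
-- integrable; the kernel w⁻¹ would not be.
lemma integral_exp_div_sq {θ : ℝ} (hθ : 0 < θ) (x : ℝ) :
    ∫ v : ℝ, cexp ((θ + v * I) * x) / (θ + v * I) ^ 2 = 2 * π * (max x 0 : ℝ) := by
  set f : ℝ → ℂ := fun x ↦ (max x 0 : ℝ) * cexp (-θ * x) with hf
  have hfc : Continuous f := by
    rw [hf]
    fun_prop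
  have hind : ∀ g : ℝ → ℂ, (fun x : ℝ ↦ ((max x 0 : ℝ) : ℂ) * g x) =
      (Ioi (0 : ℝ)).indicator fun x ↦ (x : ℂ) * g x := by
    intro g
    ext x
    by_cases hx : 0 < x
    · rw [indicator_of_mem (show x ∈ Ioi (0 : ℝ) from hx), max_eq_left hx.le]
    · rw [indicator_of_notMem (show x ∉ Ioi (0 : ℝ) from hx), max_eq_right (not_lt.1 hx)]
      simp
  have hfi : Integrable f := by
    have h0 : Integrable fun x : ℝ ↦ (1 + |x|) ^ 1 * Real.exp (-θ * |x|) :=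
      integrable_one_add_abs_pow_mul_exp hθ 1
    refine h0.mono' hfc.aestronglyMeasurable (.of_forall fun x ↦ ?_)
    rw [hf, norm_mul, norm_real, norm_exp, pow_one]
    by_cases hx : 0 < x
    · rw [max_eq_left hx.le, Real.norm_of_nonneg hx.le, abs_of_pos hx]
      simp only [neg_mul, neg_re, mul_re, ofReal_re, ofReal_im, mul_zero, sub_zero]
      gcongr
      linarith
    · rw [max_eq_right (not_lt.1 hx)]
      simp only [norm_zero, zero_mul]
      positivity
  have hF : ∀ ξ : ℝ, 𝓕 f ξ = 1 / (θ + (2 * π * ξ : ℝ) * I) ^ 2 := by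
    intro ξ
    have hre : 0 < (θ + (2 * π * ξ : ℝ) * I : ℂ).re := by simp [hθ]
    rw [Real.fourier_eq']
    have e : ∀ v : ℝ, cexp (((-2 * π * inner ℝ v ξ : ℝ) : ℂ) * I) • f v =
        (max v 0 : ℝ) * cexp (-((θ + (2 * π * ξ : ℝ) * I) * v)) := by
      intro v
      rw [hf, smul_eq_mul, mul_left_comm, ← exp_add]
      congr 2
      simp
      ring
    simp only [e]
    rw [hind, integral_indicator measurableSet_Ioi]
    rw [← integral_ofReal_mul_cexp hre]
    simp only [neg_mul]
  have hint : Integrable fun v : ℝ ↦ 1 / (θ + v * I : ℂ) ^ 2 := by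
    refine (integrable_norm_add_mul_I_rpow hθ one_lt_two).mono'
      (Continuous.aestronglyMeasurable ?_) (.of_forall fun v ↦ ?_)
    · exact continuous_const.div (by fun_prop) fun v ↦ pow_ne_zero _ (add_mul_I_ne_zero hθ v)
    · rw [norm_div, norm_one, norm_pow, Real.rpow_neg (norm_nonneg _), Real.rpow_two, one_div]
  have hFi : Integrable (𝓕 f) := by
    have : 𝓕 f = fun ξ : ℝ ↦ (fun v : ℝ ↦ 1 / (θ + v * I : ℂ) ^ 2) ((2 * π) * ξ) := by
      ext ξ; rw [hF]
    rw [this]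
    exact hint.comp_mul_left' Real.two_pi_pos.ne'
  have hinv := congrFun (hfc.fourierInv_fourier_eq hfi hFi) x
  rw [Real.fourierInv_eq'] at hinv
  have e : ∀ v : ℝ, cexp (((2 * π * inner ℝ v x : ℝ) : ℂ) * I) • 𝓕 f v =
      (fun v : ℝ ↦ cexp (v * x * I) / (θ + v * I : ℂ) ^ 2) ((2 * π) * v) := by
    intro v
    rw [hF, smul_eq_mul, ← mul_div_assoc, mul_one]
    simp only
    congr 3
    simp
    ring
  simp only [e] at hinv
  rw [Measure.integral_comp_mul_left (fun v : ℝ ↦ cexp (v * x * I) / (θ + v * I : ℂ) ^ 2)] at hinv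
  have e3 : ∀ v : ℝ, cexp ((θ + v * I) * x) / (θ + v * I) ^ 2 =
      cexp (θ * x) * (cexp (v * x * I) / (θ + v * I : ℂ) ^ 2) := by
    intro v
    rw [mul_div_assoc', ← exp_add]
    ring_nf
  have hpi : (2 * π : ℂ) ≠ 0 := by exact_mod_cast Real.two_pi_pos.ne'
  have h4 : ∫ v : ℝ, cexp (v * x * I) / (θ + v * I : ℂ) ^ 2 = 2 * π * f x := by
    rw [← hinv, abs_of_pos (by positivity), real_smul]
    push_cast
    rw [mul_inv_cancel_left₀ hpi]
  simp only [e3]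
  rw [integral_const_mul, h4, hf]
  have h5 : cexp (θ * x) * cexp (-θ * x) = 1 := by rw [← exp_add]; simp
  linear_combination (2 * π * (max x 0 : ℝ) : ℂ) * h5

/-- Perron's formula with the kernel `w⁻²`. -/
lemma integral_laplace_mul_exp_div_sq {θ : ℝ} (hθ : 0 < θ) (Y : ℝ) :
    ∫ v : ℝ, (∫ t in Ioi (0 : ℝ), (zetaDev t : ℂ) * cexp (-(θ + v * I) * t)) *
        (cexp ((θ + v * I) * Y) / (θ + v * I) ^ 2) =
      2 * π * (∫ t in Ioi (0 : ℝ), zetaDev t * max (Y - t) 0 : ℝ) := by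
  have hre : ∀ v : ℝ, (θ + v * I : ℂ).re = θ := fun v ↦ by simp
  have hmeas := measurable_zetaDev
  set F : ℝ → ℝ → ℂ := fun v t ↦
    (zetaDev t : ℂ) * cexp (-(θ + v * I) * t) * (cexp ((θ + v * I) * Y) / (θ + v * I) ^ 2) with hF
  have hFm : Measurable (Function.uncurry F) := by
    simp only [hF, Function.uncurry_def]
    fun_prop
  have i1 := (integrableOn_and_integral_zetaDev (w := θ) (by simpa using hθ)).1.norm
  have i2 := (integrable_norm_add_mul_I_rpow hθ one_lt_two).const_mul (Real.exp (θ * Y))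
  have hFi : Integrable (Function.uncurry F) (volume.prod (volume.restrict (Ioi 0))) := by
    refine (i2.mul_prod i1).mono' hFm.aestronglyMeasurable (.of_forall fun z ↦ le_of_eq ?_)
    simp only [hF, Function.uncurry_def]
    rw [norm_mul, norm_mul, norm_mul, norm_div, norm_exp, norm_exp, norm_exp, norm_pow,
      Real.rpow_neg (norm_nonneg _), Real.rpow_two, div_eq_mul_inv]
    simp
    ring
  have e1 : ∀ v : ℝ, (∫ t in Ioi (0 : ℝ), (zetaDev t : ℂ) * cexp (-(θ + v * I) * t)) *
      (cexp ((θ + v * I) * Y) / (θ + v * I) ^ 2) = ∫ t in Ioi (0 : ℝ), F v t := fun v ↦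
    (integral_mul_const _ _).symm
  have e2 : ∀ t : ℝ, ∫ v : ℝ, F v t = 2 * π * ((zetaDev t * max (Y - t) 0 : ℝ) : ℂ) := by
    intro t
    have e3 : ∀ v : ℝ, F v t =
        zetaDev t * (cexp ((θ + v * I) * (Y - t : ℝ)) / (θ + v * I) ^ 2) := by
      intro v
      have : cexp ((θ + v * I) * (Y - t : ℝ)) =
          cexp (-(θ + v * I) * t) * cexp ((θ + v * I) * Y) := by
        rw [← exp_add]; push_cast; ring_nf
      rw [hF, this]
      ring
    simp only [e3]
    rw [integral_const_mul, integral_exp_div_sq hθ]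
    push_cast
    ring
  simp only [e1]
  rw [integral_integral_swap hFi]
  simp only [e2]
  rw [integral_const_mul, integral_complex_ofReal]

lemma intervalIntegrable_zetaDev (a b : ℝ) : IntervalIntegrable zetaDev volume a b :=
  ((continuous_zetaSq.intervalIntegrable a b).sub
    intervalIntegral.intervalIntegrable_log').sub intervalIntegrable_const

/-- The Riesz mean of `zetaDev`. -/
noncomputable def rieszMean (Y : ℝ) : ℝ := ∫ t in (0 : ℝ)..Y, (Y - t) * zetaDev t

lemma rieszMean_eq {Y : ℝ} (hY : 0 ≤ Y) :
    rieszMean Y = ∫ t in Ioi (0 : ℝ), zetaDev t * max (Y - t) 0 := by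
  rw [rieszMean, intervalIntegral.integral_of_le hY, ← integral_indicator measurableSet_Ioc,
    ← integral_indicator measurableSet_Ioi]
  congr 1
  ext t
  simp only [indicator, mem_Ioc, mem_Ioi]
  by_cases h0 : 0 < t
  · by_cases h1 : t ≤ Y
    · simp [h0, h1, mul_comm]
    · simp [h0, h1, max_eq_right (show Y - t ≤ 0 by linarith)]
  · simp [h0]

/-- On the line re w = θ = 1/Y the factor exp(wY) has modulus e. The error integrated against |w|⁻²
is θ^(−5/4) ∫ |w|^(−5/4), of order θ^(−5/4 − 1/4) = Y^(3/2). -/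
theorem exists_abs_rieszMean_le :
    ∃ C, 0 ≤ C ∧ ∀ Y : ℝ, 1 ≤ Y → |rieszMean Y| ≤ C * Y ^ (3 / 2 : ℝ) := by
  obtain ⟨C, hC, h⟩ := exists_norm_zetaLaplace_sub_le
  set K := ∫ v : ℝ, (1 + ‖v‖ ^ 2) ^ (-(5 / 4 : ℝ) / 2) with hK
  have hK0 : 0 ≤ K := integral_nonneg fun v ↦ by positivity
  refine ⟨C * Real.exp 1 * K, by positivity, fun Y hY ↦ ?_⟩
  have hY0 : 0 < Y := by linarith
  set θ := Y⁻¹ with hθ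
  have hθ0 : 0 < θ := by positivity
  have hθ1 : θ ≤ 1 := inv_le_one_of_one_le₀ hY
  have hP := integral_laplace_mul_exp_div_sq hθ0 Y
  rw [← rieszMean_eq hY0.le] at hP
  have hb : ‖∫ v : ℝ, (∫ t in Ioi (0 : ℝ), (zetaDev t : ℂ) * cexp (-(θ + v * I) * t)) *
        (cexp ((θ + v * I) * Y) / (θ + v * I) ^ 2)‖ ≤
      ∫ v : ℝ, C * θ ^ (-(5 / 4) : ℝ) * Real.exp 1 * ‖(θ + v * I : ℂ)‖ ^ (-(5 / 4 : ℝ)) := by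
    refine norm_integral_le_of_norm_le
      ((integrable_norm_add_mul_I_rpow hθ0 (by norm_num)).const_mul _) (.of_forall fun v ↦ ?_)
    have hre : (θ + v * I : ℂ).re = θ := by simp
    have hw := h (θ + v * I) (by rw [hre]; exact hθ0) (by rw [hre]; exact hθ1)
    rw [← (integrableOn_and_integral_zetaDev (by rw [hre]; exact hθ0)).2, hre] at hw
    have hn : 0 < ‖(θ + v * I : ℂ)‖ := norm_pos_iff.2 (add_mul_I_ne_zero hθ0 v)
    have he : ‖cexp ((θ + v * I) * Y)‖ = Real.exp 1 := by
      rw [norm_exp]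
      congr 1
      simp [hθ, hY0.ne']
    rw [norm_mul, norm_div, he, norm_pow]
    calc _ ≤ C * (‖(θ + v * I : ℂ)‖ ^ (3 / 4 : ℝ) * θ ^ (-(5 / 4) : ℝ)) *
          (Real.exp 1 / ‖(θ + v * I : ℂ)‖ ^ 2) := by gcongr
      _ = C * θ ^ (-(5 / 4) : ℝ) * Real.exp 1 *
          (‖(θ + v * I : ℂ)‖ ^ (3 / 4 : ℝ) * ‖(θ + v * I : ℂ)‖ ^ (-2 : ℝ)) := by
            rw [Real.rpow_neg hn.le, Real.rpow_two, div_eq_mul_inv]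
            ring
      _ = _ := by
            rw [← Real.rpow_add hn]
            norm_num
  rw [hP, integral_const_mul, integral_norm_add_mul_I_rpow hθ0, ← hK, norm_mul, norm_real,
    Real.norm_eq_abs] at hb
  have hpi : ‖(2 * π : ℂ)‖ = 2 * π := by simp [abs_of_pos Real.pi_pos]
  have h1 : |rieszMean Y| ≤ 2 * π * |rieszMean Y| :=
    le_mul_of_one_le_left (abs_nonneg _) (by linarith [Real.pi_gt_three])
  rw [hpi] at hb
  refine h1.trans (hb.trans_eq ?_)
  have h2 : θ ^ (-(5 / 4) : ℝ) * θ ^ (1 - 5 / 4 : ℝ) = Y ^ (3 / 2 : ℝ) := by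
    rw [← Real.rpow_add hθ0, hθ, Real.inv_rpow hY0.le, ← Real.rpow_neg hY0.le]
    norm_num
  rw [← h2]
  ring

/-! ### The Tauberian step from the Riesz mean to the integral. -/

/-- The Tauberian condition: it needs only |ζ|² ≥ 0, no upper bound on ζ. -/
lemma neg_le_zetaDev {t b : ℝ} (ht : 1 ≤ t) (htb : t ≤ b) :
    -(Real.log b + |meanConst|) ≤ zetaDev t := by
  have h1 := zetaSq_nonneg t
  have h2 := Real.log_le_log (by linarith) htb
  have h3 := le_abs_self meanConst
  unfold zetaDev
  linarith

lemma rieszMean_sub_eq (a b : ℝ) :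
    rieszMean b - rieszMean a =
      (b - a) * (∫ t in (0 : ℝ)..a, zetaDev t) + ∫ t in a..b, (b - t) * zetaDev t := by
  have hi : ∀ x y c : ℝ, IntervalIntegrable (fun t ↦ (c - t) * zetaDev t) volume x y :=
    fun x y c ↦ (intervalIntegrable_zetaDev x y).continuousOn_mul (by fun_prop)
  rw [rieszMean, rieszMean, ← intervalIntegral.integral_add_adjacent_intervals (hi 0 a b) (hi a b b),
    ← intervalIntegral.integral_const_mul, add_sub_right_comm,
    ← intervalIntegral.integral_sub (hi 0 a b) (hi 0 a a)]
  congr 1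
  refine intervalIntegral.integral_congr fun t _ ↦ ?_
  ring

/-- The increment of the Riesz mean exceeds the left side by an integral over [a, b] with weight b −
t in [0, b − a], which the one-sided bound controls from below. -/
lemma mul_integral_zetaDev_le {a b : ℝ} (ha : 1 ≤ a) (hab : a ≤ b) :
    (b - a) * (∫ t in (0 : ℝ)..a, zetaDev t) ≤
      rieszMean b - rieszMean a + (b - a) ^ 2 * (Real.log b + |meanConst|) := by
  set M := Real.log b + |meanConst| with hM
  have hM0 : 0 ≤ M := add_nonneg (Real.log_nonneg (by linarith)) (abs_nonneg _)
  have h : ∫ _ in a..b, -((b - a) * M) ≤ ∫ t in a..b, (b - t) * zetaDev t := by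
    refine intervalIntegral.integral_mono_on hab intervalIntegrable_const
      ((intervalIntegrable_zetaDev a b).continuousOn_mul (by fun_prop)) fun t ht ↦ ?_
    have h1 := neg_le_zetaDev (ha.trans ht.1) ht.2
    nlinarith [ht.1, ht.2]
  rw [intervalIntegral.integral_const, smul_eq_mul] at h
  rw [rieszMean_sub_eq]
  nlinarith

/-- The mirror image: the discrepancy now carries the weight t − a, again between 0 and b − a. -/
lemma le_mul_integral_zetaDev {a b : ℝ} (ha : 1 ≤ a) (hab : a ≤ b) :
    rieszMean b - rieszMean a - (b - a) ^ 2 * (Real.log b + |meanConst|) ≤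
      (b - a) * ∫ t in (0 : ℝ)..b, zetaDev t := by
  set M := Real.log b + |meanConst| with hM
  have hM0 : 0 ≤ M := add_nonneg (Real.log_nonneg (by linarith)) (abs_nonneg _)
  have h : ∫ _ in a..b, -((b - a) * M) ≤ ∫ t in a..b, (b - a) * zetaDev t - (b - t) * zetaDev t := by
    have hi : ∀ c : ℝ → ℝ, Continuous c →
        IntervalIntegrable (fun t ↦ c t * zetaDev t) volume a b :=
      fun c hc ↦ (intervalIntegrable_zetaDev a b).continuousOn_mul hc.continuousOn
    refine intervalIntegral.integral_mono_on hab intervalIntegrable_const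
      ((hi _ (by fun_prop)).sub (hi _ (by fun_prop))) fun t ht ↦ ?_
    have h1 := neg_le_zetaDev (ha.trans ht.1) ht.2
    nlinarith [ht.1, ht.2]
  rw [intervalIntegral.integral_const, smul_eq_mul, intervalIntegral.integral_sub
    ((intervalIntegrable_zetaDev a b).const_mul _)
    ((intervalIntegrable_zetaDev a b).continuousOn_mul (by fun_prop)),
    intervalIntegral.integral_const_mul] at h
  rw [rieszMean_sub_eq, ← intervalIntegral.integral_add_adjacent_intervals
    (intervalIntegrable_zetaDev 0 a) (intervalIntegrable_zetaDev a b)]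
  nlinarith

theorem exists_abs_integral_zetaDev_le :
    ∃ C, ∀ Y : ℝ, 16 ≤ Y → |∫ t in (0 : ℝ)..Y, zetaDev t| ≤ C * Y ^ (7 / 8 : ℝ) := by
  obtain ⟨C, hC, h⟩ := exists_abs_rieszMean_le
  refine ⟨2 * (C * 4) + (16 + |meanConst|), fun Y hY ↦ ?_⟩
  have hY0 : 0 < Y := by linarith
  -- This balances Y^(3/2)/Δ against Δ log Y, the logarithm costing Y^(1/8). For Y ≥ 16 it satisfies
  -- 2Δ ≤ Y, so Y ± Δ stay between 1 and 2Y.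
  set Δ := Y ^ (3 / 4 : ℝ) with hΔ
  have hΔ0 : 0 < Δ := by positivity
  have h4 : 2 ≤ Y ^ (1 / 4 : ℝ) := by
    calc (2 : ℝ) = (2 ^ (4 : ℝ)) ^ (1 / 4 : ℝ) := by rw [← Real.rpow_mul (by norm_num)]; norm_num
      _ ≤ _ := by gcongr; norm_num; exact hY
  have hYΔ : Y = Y ^ (1 / 4 : ℝ) * Δ := by
    rw [hΔ, ← Real.rpow_add hY0]; norm_num
  have hΔY : 2 * Δ ≤ Y := by
    calc 2 * Δ ≤ Y ^ (1 / 4 : ℝ) * Δ := by gcongr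
      _ = Y := hYΔ.symm
  have hR : ∀ X : ℝ, 1 ≤ X → X ≤ 2 * Y → |rieszMean X| ≤ C * 4 * (Y ^ (3 / 4 : ℝ) * Δ) := by
    intro X h1 h2
    refine (h X h1).trans ?_
    have h5 : (2 : ℝ) ^ (3 / 2 : ℝ) ≤ 4 := by
      calc (2 : ℝ) ^ (3 / 2 : ℝ) ≤ 2 ^ (2 : ℝ) := by gcongr <;> norm_num
        _ = 4 := by norm_num
    calc C * X ^ (3 / 2 : ℝ) ≤ C * (2 * Y) ^ (3 / 2 : ℝ) := by gcongr
      _ = C * (2 ^ (3 / 2 : ℝ) * Y ^ (3 / 2 : ℝ)) := by rw [Real.mul_rpow zero_le_two hY0.le]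
      _ ≤ C * (4 * Y ^ (3 / 2 : ℝ)) := by gcongr
      _ = _ := by
        rw [hΔ, ← Real.rpow_add hY0]
        norm_num
        ring
  have hlog : ∀ X : ℝ, 1 ≤ X → X ≤ 2 * Y →
      Real.log X + |meanConst| ≤ (16 + |meanConst|) * Y ^ (1 / 8 : ℝ) := by
    intro X h1 h2
    have h5 := Real.log_le_rpow_div (x := X) (ε := 1 / 8) (by linarith) (by norm_num)
    have h6 : X ^ (1 / 8 : ℝ) ≤ 2 * Y ^ (1 / 8 : ℝ) := by
      calc X ^ (1 / 8 : ℝ) ≤ (2 * Y) ^ (1 / 8 : ℝ) := by gcongr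
        _ = 2 ^ (1 / 8 : ℝ) * Y ^ (1 / 8 : ℝ) := Real.mul_rpow zero_le_two hY0.le
        _ ≤ 2 ^ (1 : ℝ) * Y ^ (1 / 8 : ℝ) := by gcongr <;> norm_num
        _ = _ := by norm_num
    have h7 : 1 ≤ Y ^ (1 / 8 : ℝ) := Real.one_le_rpow (by linarith) (by norm_num)
    have h8 := le_mul_of_one_le_right (abs_nonneg meanConst) h7
    linarith
  have hD8 : Δ * Y ^ (1 / 8 : ℝ) = Y ^ (7 / 8 : ℝ) := by
    rw [hΔ, ← Real.rpow_add hY0]; norm_num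
  have h34 : Y ^ (3 / 4 : ℝ) ≤ Y ^ (7 / 8 : ℝ) :=
    Real.rpow_le_rpow_of_exponent_le (by linarith) (by norm_num)
  have r1 := abs_le.1 (hR Y (by linarith) (by linarith))
  have r2 := abs_le.1 (hR (Y + Δ) (by linarith) (by linarith))
  have r3 := abs_le.1 (hR (Y - Δ) (by linarith) (by linarith))
  have l1 := hlog Y (by linarith) (by linarith)
  have l2 := hlog (Y + Δ) (by linarith) (by linarith)
  have up := mul_integral_zetaDev_le (a := Y) (b := Y + Δ) (by linarith) (by linarith)
  have lo := le_mul_integral_zetaDev (a := Y - Δ) (b := Y) (by linarith) (by linarith)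
  rw [add_sub_cancel_left] at up
  rw [sub_sub_cancel] at lo
  set J := ∫ t in (0 : ℝ)..Y, zetaDev t
  have m1 := mul_le_mul_of_nonneg_left l1 (sq_nonneg Δ)
  have m2 := mul_le_mul_of_nonneg_left l2 (sq_nonneg Δ)
  have e : Δ ^ 2 * ((16 + |meanConst|) * Y ^ (1 / 8 : ℝ)) =
      Δ * ((16 + |meanConst|) * Y ^ (7 / 8 : ℝ)) := by rw [← hD8]; ring
  rw [e] at m1 m2
  have hfin : 2 * (C * 4 * Y ^ (3 / 4 : ℝ)) + (16 + |meanConst|) * Y ^ (7 / 8 : ℝ) ≤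
      (2 * (C * 4) + (16 + |meanConst|)) * Y ^ (7 / 8 : ℝ) := by
    have := mul_le_mul_of_nonneg_left h34 (show 0 ≤ C * 4 by positivity)
    linarith
  refine le_trans ?_ hfin
  rw [abs_le]
  constructor
  · refine le_of_mul_le_mul_left ?_ hΔ0
    linarith [lo, r1.1, r3.2]
  · refine le_of_mul_le_mul_left ?_ hΔ0
    linarith [up, r1.1, r2.2]

theorem tendsto_integral_zetaDev_div :
    Tendsto (fun Y : ℝ ↦ (∫ t in (0 : ℝ)..Y, zetaDev t) / Y) atTop (𝓝 0) := by
  obtain ⟨C, h⟩ := exists_abs_integral_zetaDev_le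
  have h0 : Tendsto (fun Y : ℝ ↦ C * Y ^ (-(1 / 8) : ℝ)) atTop (𝓝 0) := by
    simpa using (tendsto_rpow_neg_atTop (show (0 : ℝ) < 1 / 8 by norm_num)).const_mul C
  refine squeeze_zero_norm' ?_ h0
  filter_upwards [eventually_ge_atTop 16] with Y hY
  have hY0 : 0 < Y := by linarith
  rw [norm_div, Real.norm_eq_abs, Real.norm_of_nonneg hY0.le, div_le_iff₀ hY0]
  refine (h Y hY).trans_eq ?_
  rw [mul_assoc, ← Real.rpow_add_one hY0.ne']
  norm_num

/-! ### The mean value and the evaluation of L. -/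

lemma logZetaIntegrand_eq (t : ℝ) : logZetaIntegrand t = -zetaDev t - meanConst := by
  unfold logZetaIntegrand zetaDev zetaSq
  ring

theorem tendsto_logHardyLittlewood_div :
    Tendsto (fun T : ℝ ↦ logHardyLittlewood T / T) atTop (𝓝 (-meanConst)) := by
  have h := tendsto_integral_zetaDev_div.neg.sub_const meanConst
  rw [neg_zero, zero_sub] at h
  refine h.congr' ?_
  filter_upwards [eventually_gt_atTop 0] with T hT
  unfold logHardyLittlewood
  simp only [logZetaIntegrand_eq]
  have hi : IntervalIntegrable (fun t ↦ -zetaDev t) volume 0 T := (intervalIntegrable_zetaDev 0 T).neg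
  rw [intervalIntegral.integral_sub hi intervalIntegrable_const,
    intervalIntegral.integral_neg, intervalIntegral.integral_const, smul_eq_mul]
  field_simp
  ring

/-- The sign ensures that the upper limit qτ/(ln 2π − 2c) tends to +∞. It follows from γ < 2/3 and
log 2π > 4/3, the latter because e⁴ < 6³ and π > 3. -/
lemma meanConst_neg : meanConst < 0 := by
  have h1 := Real.eulerMascheroniConstant_lt_two_thirds
  have h2 : 4 / 3 < Real.log (2 * π) := by
    rw [Real.lt_log_iff_exp_lt Real.two_pi_pos]
    have h3 : Real.exp (4 / 3) ^ 3 < 6 ^ 3 := by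
      rw [← Real.exp_nat_mul]
      have h4 := Real.exp_one_lt_d9
      calc Real.exp ((3 : ℕ) * (4 / 3)) = Real.exp 1 ^ 4 := by
            rw [← Real.exp_nat_mul]; norm_num
        _ < 2.7182818286 ^ 4 := by gcongr
        _ < 6 ^ 3 := by norm_num
    have h5 := lt_of_pow_lt_pow_left₀ 3 (by norm_num) h3
    linarith [Real.pi_gt_three]
  unfold meanConst
  linarith

theorem tendsto_logZetaMean {q : ℝ} (hq : 0 < q) : Tendsto (logZetaMean q) atTop (𝓝 q) := by
  have hκ : 0 < -meanConst := neg_pos.2 meanConst_neg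
  have hT : Tendsto (fun τ : ℝ ↦ q * (τ / -meanConst)) atTop atTop :=
    (tendsto_id.atTop_div_const hκ).const_mul_atTop hq
  have h := (tendsto_logHardyLittlewood_div.comp hT).const_mul (q / -meanConst)
  rw [div_mul_cancel₀ _ hκ.ne'] at h
  refine h.congr' ?_
  filter_upwards [eventually_gt_atTop 0] with τ hτ
  have e : Real.log (2 * π) - 2 * Real.eulerMascheroniConstant = -meanConst := by
    unfold meanConst; ring
  rw [logZetaMean, e, Function.comp_apply, one_div_mul_eq_div]
  have := hκ.ne'
  generalize -meanConst = κ at *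
  field_simp

theorem logZetaLimit_eq {q : ℝ} (hq : 0 < q) : logZetaLimit q = q :=
  (tendsto_logZetaMean hq).limUnder_eq

lemma isFermatRational_pos {q : ℝ} (h : IsFermatRational q) : 0 < q := by
  obtain ⟨x, y, z, n, hx, hy, hz, -, rfl⟩ := h
  positivity

end ZetaMeanSquare

theorem corollary1 (ε : ℝ) (hε : 0 < ε) :
    (∀ q ∈ Set.Ioo (1 - ε) (1 + ε), IsFermatRational q →
      Tendsto (logZetaMean q) atTop (𝓝 (logZetaLimit q))) ∧
    ((∀ q ∈ Set.Ioo (1 - ε) (1 + ε), IsFermatRational q → logZetaLimit q ≠ 1) ↔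
      FermatLastTheorem) := by
  refine ⟨fun q _ hq ↦ ?_, fun h n hn a b c ha hb hc habc ↦ ?_, fun h q _ hq h1 ↦ ?_⟩
  · rw [ZetaMeanSquare.logZetaLimit_eq (ZetaMeanSquare.isFermatRational_pos hq)]
    exact ZetaMeanSquare.tendsto_logZetaMean (ZetaMeanSquare.isFermatRational_pos hq)
  -- A solution of Fermat's equation makes 1 itself a Fermat rational, where L takes the forbidden
  -- value 1.
  · have hq : IsFermatRational 1 := by
      refine ⟨a, b, c, n, ha.pos, hb.pos, hc.pos, hn, ?_⟩
      have hc' : (c : ℝ) ^ n ≠ 0 := pow_ne_zero _ (Nat.cast_ne_zero.2 hc)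
      rw [eq_div_iff hc', one_mul]
      exact_mod_cast habc.symm
    exact h 1 ⟨by linarith, by linarith⟩ hq (ZetaMeanSquare.logZetaLimit_eq one_pos)
  · rw [ZetaMeanSquare.logZetaLimit_eq (ZetaMeanSquare.isFermatRational_pos hq)] at h1
    obtain ⟨x, y, z, n, hx, hy, hz, hn, rfl⟩ := hq
    have hz' : (z : ℝ) ^ n ≠ 0 := pow_ne_zero _ (Nat.cast_ne_zero.2 hz.ne')
    rw [div_eq_one_iff_eq hz'] at h1
    exact h n hn x y z hx.ne' hy.ne' hz.ne' (by exact_mod_cast h1)
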